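/- Let ${n \brack k}$ denote the Stirling cycle numbers (unsigned Stirling numbers of the first kind), and for real $\sigma>0$ and $\tau$ consider the series $$u(\sigma,\tau)=\sum_{n=1}^\infty\left(\sum_{m=1}^n(-1)^{n-m}{n\brack n-m+1}\frac{\sigma^{n-m}\tau^m}{m!}\right),$$ summed over $n$. Let $W_{-1}$ be the branch of the Lambert function (the inverse of $w\mapsto we^w$) with index $-1$; at a negative real $x$ it is the solution $w$ of $we^w=x$ that is real with $w\le -1$ if $-1/e\le x<0$, and that satisfies $-\pi<\operatorname{Im}w<0$ if $x<-1/e$. (1) For each fixed real $\lambda\neq 0$, substituting $\tau=\lambda\sigma$ turns the series into a power series $\sum_{n\ge1}a_n(\lambda)\sigma^n$, $a_n(\lambda)=\sum_{m=1}^n(-1)^{n-m}{n\brack n-m+1}\frac{\lambda^m}{m!}$, in the complex variable $\sigma$, whose radius of convergence is exactly $\exp\left(1-\lambda+\operatorname{Re}W_{-1}(-e^{\lambda-1})\right)$. (2) The domain of convergence of the series is defined by the inequality $$\ln\sigma<1-\frac{\tau}{\sigma}+\operatorname{Re}W_{-1}\left(-e^{\tau/\sigma-1}\right).\qquad(*)$$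 That is: if $\sigma>0$ and $\tau\in\mathbb R$ satisfy $(*)$, the series converges; if $\sigma>0$, $\tau\ne0$ and the strict inequality opposite to $(*)$ holds, the series diverges; and the set of all $(\sigma,\tau)$ with $\sigma>0$ satisfying $(*)$ is precisely the interior of the set of all $(\sigma,\tau)\in\mathbb R^2$ with $\sigma>0$ at which the series converges. -/

import Mathlib

open Filter Topology

noncomputable section

/-! ### The branch `W₋₁` of the Lambert function -/

/-- The range of the branch `W₋₁`.  Apart from the real half-line `(-∞, -1]`, the range of the
branch `W_k` consists of the `w` for which `w + Log w - 2 k π i` has imaginary part in `(-π, π]`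
(`Log` is the principal logarithm); here `k = -1`. -/
def LambertWNegOneRange (w : ℂ) : Prop :=
  (w.im = 0 ∧ w.re ≤ -1) ∨
    (-(3 * Real.pi) < (w + Complex.log w).im ∧ (w + Complex.log w).im ≤ -Real.pi)

/-- `w` is the value at `z` of the branch `W₋₁` of the inverse of `w ↦ w * exp w`. -/
def IsLambertWNegOne (z w : ℂ) : Prop :=
  w * Complex.exp w = z ∧ LambertWNegOneRange w

open Classical in
/-- The branch `W₋₁` of the Lambert function.  It is used below at negative real points only,
where `existsUnique_isLambertWNegOne` shows that it is well defined. -/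
def lambertWNegOne (z : ℂ) : ℂ :=
  if h : ∃ w, IsLambertWNegOne z w then h.choose else 0

/-! Well-definedness of `W₋₁` on the negative real axis. -/

/-- For `-π < η < 0`, the point `-η cot η + i η` is mapped by `w ↦ w * exp w` to
`-exp (lambertAux (-η))`. -/
def lambertAux (t : ℝ) : ℝ := Real.log t - Real.log (Real.sin t) - t * Real.cos t / Real.sin t

theorem hasDerivAt_lambertAux {t : ℝ} (h0 : 0 < t) (hp : t < Real.pi) :
    HasDerivAt lambertAux (t⁻¹ - Real.cos t / Real.sin t -
      ((1 * Real.cos t + t * (-Real.sin t)) * Real.sin t - t * Real.cos t * Real.cos t)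
        / Real.sin t ^ 2) t := by
  have hs := Real.sin_pos_of_pos_of_lt_pi h0 hp
  exact ((Real.hasDerivAt_log h0.ne').sub ((Real.hasDerivAt_sin t).log hs.ne')).sub
    (((hasDerivAt_id t).mul (Real.hasDerivAt_cos t)).div (Real.hasDerivAt_sin t) hs.ne')

theorem continuousOn_lambertAux : ContinuousOn lambertAux (Set.Ioo 0 Real.pi) :=
  fun _ ht => (hasDerivAt_lambertAux ht.1 ht.2).continuousAt.continuousWithinAt

theorem strictMonoOn_lambertAux : StrictMonoOn lambertAux (Set.Ioo 0 Real.pi) := by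
  refine strictMonoOn_of_deriv_pos (convex_Ioo 0 Real.pi) continuousOn_lambertAux ?_
  intro t ht
  rw [interior_Ioo] at ht
  have hs := Real.sin_pos_of_pos_of_lt_pi ht.1 ht.2
  have h0 : 0 < t := ht.1
  rw [(hasDerivAt_lambertAux ht.1 ht.2).deriv]
  have hlt : Real.sin t < t := Real.sin_lt h0
  have e : t⁻¹ - Real.cos t / Real.sin t -
      ((1 * Real.cos t + t * (-Real.sin t)) * Real.sin t - t * Real.cos t * Real.cos t)
        / Real.sin t ^ 2 =
      ((Real.sin t - t * Real.cos t) ^ 2 + t ^ 2 * Real.sin t ^ 2) / (t * Real.sin t ^ 2) := by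
    have h2 := Real.sin_sq_add_cos_sq t
    field_simp
    ring
  rw [e]
  positivity

theorem mul_cos_lt_sin {t : ℝ} (h0 : 0 < t) (hp : t < Real.pi) :
    t * Real.cos t < Real.sin t := by
  have hs := Real.sin_pos_of_pos_of_lt_pi h0 hp
  rcases lt_or_ge t (Real.pi / 2) with h | h
  · have hc : 0 < Real.cos t := Real.cos_pos_of_mem_Ioo ⟨by linarith, h⟩
    have := Real.lt_tan h0 h
    rw [Real.tan_eq_sin_div_cos, lt_div_iff₀ hc] at this
    exact this
  · have hc : Real.cos t ≤ 0 := Real.cos_nonpos_of_pi_div_two_le_of_le h (by linarith)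
    nlinarith

theorem neg_one_lt_lambertAux {t : ℝ} (h0 : 0 < t) (hp : t < Real.pi) : -1 < lambertAux t := by
  have hs := Real.sin_pos_of_pos_of_lt_pi h0 hp
  have h1 : Real.log (Real.sin t) ≤ Real.log t := Real.log_le_log hs (Real.sin_lt h0).le
  have h2 : t * Real.cos t / Real.sin t < 1 := by
    rw [div_lt_one hs]; exact mul_cos_lt_sin h0 hp
  unfold lambertAux
  linarith

theorem exists_lambertAux_eq {y : ℝ} (hy : -1 < y) :
    ∃ t ∈ Set.Ioo 0 Real.pi, lambertAux t = y := by
  have hpi := Real.pi_pos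
  have hconn : IsPreconnected (Set.Ioo (0 : ℝ) Real.pi) := isPreconnected_Ioo
  have hlow : ∃ a ∈ Set.Ioo 0 Real.pi, lambertAux a ≤ y := by
    have hsinc : Tendsto (fun t : ℝ => Real.sin t / t) (𝓝[>] 0) (𝓝 1) := by
      have h := (Real.hasDerivAt_sin 0).tendsto_slope_zero_right
      simp only [zero_add, Real.sin_zero, sub_zero, Real.cos_zero, smul_eq_mul] at h
      refine h.congr fun t => ?_
      rw [div_eq_inv_mul]
    have hcos : Tendsto Real.cos (𝓝[>] 0) (𝓝 1) := by
      have := Real.continuous_cos.tendsto 0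
      rw [Real.cos_zero] at this
      exact this.mono_left nhdsWithin_le_nhds
    have hlim : Tendsto (fun t : ℝ => -Real.log (Real.sin t / t) - Real.cos t / (Real.sin t / t))
        (𝓝[>] 0) (𝓝 (-Real.log 1 - 1 / 1)) :=
      ((hsinc.log one_ne_zero).neg).sub (hcos.div hsinc one_ne_zero)
    have hev := hlim.eventually_le_const (u := y) (by simpa using hy)
    have hmem : Set.Ioo (0 : ℝ) Real.pi ∈ 𝓝[>] (0 : ℝ) := Ioo_mem_nhdsGT hpi
    obtain ⟨t, ht, htm⟩ := (hev.and hmem).exists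
    have hs := Real.sin_pos_of_pos_of_lt_pi htm.1 htm.2
    refine ⟨t, htm, ?_⟩
    rw [Real.log_div hs.ne' htm.1.ne'] at ht
    unfold lambertAux
    have e : Real.cos t / (Real.sin t / t) = t * Real.cos t / Real.sin t := by
      rw [div_div_eq_mul_div, mul_comm]
    linarith
  have hhigh : ∃ b ∈ Set.Ioo 0 Real.pi, y ≤ lambertAux b := by
    have hsin : Tendsto Real.sin (𝓝[<] Real.pi) (𝓝[>] 0) := by
      refine tendsto_nhdsWithin_iff.2 ⟨?_, ?_⟩
      · have := Real.continuous_sin.tendsto Real.pi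
        rw [Real.sin_pi] at this
        exact this.mono_left nhdsWithin_le_nhds
      · filter_upwards [Ioo_mem_nhdsLT hpi] with t ht
        exact Real.sin_pos_of_pos_of_lt_pi ht.1 ht.2
    have hlog : Tendsto (fun t => Real.log (Real.sin t)) (𝓝[<] Real.pi) atBot :=
      Real.tendsto_log_nhdsGT_zero.comp hsin
    have hev := hlog.eventually_le_atBot (-y)
    have hmem : Set.Ioo (Real.pi / 2) Real.pi ∈ 𝓝[<] Real.pi := Ioo_mem_nhdsLT (by linarith)
    obtain ⟨t, ht, htm⟩ := (hev.and hmem).exists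
    have h0 : 0 < t := by linarith [htm.1]
    have hs := Real.sin_pos_of_pos_of_lt_pi h0 htm.2
    refine ⟨t, ⟨h0, htm.2⟩, ?_⟩
    have hc : Real.cos t ≤ 0 := Real.cos_nonpos_of_pi_div_two_le_of_le htm.1.le (by linarith [htm.2])
    have h1 : t * Real.cos t / Real.sin t ≤ 0 :=
      div_nonpos_of_nonpos_of_nonneg (mul_nonpos_of_nonneg_of_nonpos h0.le hc) hs.le
    have h2 : 0 ≤ Real.log t :=
      Real.log_nonneg (by linarith [htm.1, Real.pi_gt_three])
    unfold lambertAux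
    linarith
  obtain ⟨a, ha, hay⟩ := hlow
  obtain ⟨b, hb, hby⟩ := hhigh
  obtain ⟨t, ht, h⟩ := hconn.intermediate_value ha hb continuousOn_lambertAux ⟨hay, hby⟩
  exact ⟨t, ht, h⟩

/-- The non-real values of `W₋₁` at negative real points. -/
theorem lambert_nonreal_iff {x : ℝ} (hx : x < 0) (w : ℂ) :
    (w * Complex.exp w = x ∧ -(3 * Real.pi) < (w + Complex.log w).im ∧
        (w + Complex.log w).im ≤ -Real.pi) ↔
      ∃ t ∈ Set.Ioo 0 Real.pi, lambertAux t = Real.log (-x) ∧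
        w = ⟨-(t * Real.cos t / Real.sin t), -t⟩ := by
  have hpi := Real.pi_pos
  have hexp : Complex.exp ((Real.log (-x) : ℂ) - Real.pi * Complex.I) = x := by
    rw [Complex.exp_sub, Complex.exp_pi_mul_I, ← Complex.ofReal_exp,
      Real.exp_log (neg_pos.2 hx)]
    push_cast
    ring
  constructor
  · rintro ⟨hw, h1, h2⟩
    have hw0 : w ≠ 0 := by
      rintro rfl
      rw [zero_mul] at hw
      exact hx.ne (by exact_mod_cast hw.symm)
    have hs : Complex.exp (w + Complex.log w) =
        Complex.exp ((Real.log (-x) : ℂ) - Real.pi * Complex.I) := by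
      rw [hexp, Complex.exp_add, Complex.exp_log hw0, mul_comm, hw]
    obtain ⟨n, hn⟩ := Complex.exp_eq_exp_iff_exists_int.1 hs
    have hre := congrArg Complex.re hn
    have him := congrArg Complex.im hn
    simp only [Complex.add_re, Complex.add_im, Complex.sub_re, Complex.sub_im, Complex.mul_re,
      Complex.mul_im, Complex.ofReal_re, Complex.ofReal_im, Complex.I_re, Complex.I_im,
      Complex.intCast_re, Complex.intCast_im, Complex.re_ofNat, Complex.im_ofNat,
      Complex.log_re, Complex.log_im] at hre him h1 h2
    ring_nf at hre him h1 h2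
    rw [him] at h1 h2
    have hn1 : (-1 : ℝ) < n := by nlinarith
    have hn2 : (n : ℝ) < 1 := by nlinarith
    have hn0 : n = 0 := by
      have : (-1 : ℤ) < n := by exact_mod_cast hn1
      have : n < 1 := by exact_mod_cast hn2
      omega
    subst hn0
    simp only [Int.cast_zero, mul_zero] at him
    have ha1 := Complex.neg_pi_lt_arg w
    have hneg : w.im < 0 := by linarith
    have ha2 : w.arg < 0 := Complex.arg_neg_iff.2 hneg
    have ht : -w.im ∈ Set.Ioo 0 Real.pi := ⟨by linarith, by linarith⟩
    have hsin := Real.sin_pos_of_pos_of_lt_pi ht.1 ht.2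
    have harg : w.arg = -w.im - Real.pi := by linarith
    have hr : 0 < ‖w‖ := norm_pos_iff.2 hw0
    have e1 : w.re = -(‖w‖ * Real.cos (-w.im)) := by
      rw [← Complex.norm_mul_cos_arg w, harg, Real.cos_sub_pi]; simp
    have e2 : w.im = -(‖w‖ * Real.sin (-w.im)) := by
      conv_lhs => rw [← Complex.norm_mul_sin_arg w, harg, Real.sin_sub_pi]
      ring
    have e3 : ‖w‖ = -w.im / Real.sin (-w.im) := by
      rw [eq_div_iff hsin.ne']; linarith
    have e4 : w.re = -(-w.im * Real.cos (-w.im) / Real.sin (-w.im)) := by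
      rw [e1, e3]; ring
    refine ⟨-w.im, ht, ?_, ?_⟩
    · rw [e3, Real.log_div ht.1.ne' hsin.ne'] at hre
      unfold lambertAux
      linarith
    · apply Complex.ext
      · exact e4
      · simp
  · rintro ⟨t, ht, hl, rfl⟩
    have hsin := Real.sin_pos_of_pos_of_lt_pi ht.1 ht.2
    have hr : 0 < t / Real.sin t := div_pos ht.1 hsin
    set w : ℂ := ⟨-(t * Real.cos t / Real.sin t), -t⟩ with hwdef
    have hpolar : w = ((t / Real.sin t : ℝ) : ℂ) *
        (Complex.cos ((t - Real.pi : ℝ) : ℂ) + Complex.sin ((t - Real.pi : ℝ) : ℂ) * Complex.I) := by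
      rw [← Complex.ofReal_cos, ← Complex.ofReal_sin, Real.cos_sub_pi, Real.sin_sub_pi]
      apply Complex.ext
      · simp only [hwdef, Complex.mul_re, Complex.mul_im, Complex.add_re, Complex.add_im,
          Complex.sub_re, Complex.sub_im, Complex.ofReal_re, Complex.ofReal_im, Complex.I_re, Complex.I_im]
        ring
      · simp only [hwdef, Complex.mul_re, Complex.mul_im, Complex.add_re, Complex.add_im,
          Complex.sub_re, Complex.sub_im, Complex.ofReal_re, Complex.ofReal_im, Complex.I_re, Complex.I_im]
        field_simp
        ring
    have hmem : t - Real.pi ∈ Set.Ioc (-Real.pi) Real.pi :=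
      ⟨by linarith [ht.1], by linarith [ht.2]⟩
    have harg : w.arg = t - Real.pi := by
      rw [hpolar]; exact Complex.arg_mul_cos_add_sin_mul_I hr hmem
    have hnorm : ‖w‖ = t / Real.sin t := by
      rw [hpolar, norm_mul, Complex.norm_real, Complex.norm_cos_add_sin_mul_I, mul_one,
        Real.norm_of_nonneg hr.le]
    have hw0 : w ≠ 0 := norm_pos_iff.1 (hnorm ▸ hr)
    have hsum : w + Complex.log w = (Real.log (-x) : ℂ) - Real.pi * Complex.I := by
      apply Complex.ext
      · simp only [Complex.add_re, Complex.log_re, hnorm, Real.log_div ht.1.ne' hsin.ne', ← hl]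
        simp only [hwdef, lambertAux, Complex.mul_re, Complex.mul_im, Complex.add_re, Complex.add_im,
          Complex.sub_re, Complex.sub_im, Complex.ofReal_re, Complex.ofReal_im, Complex.I_re, Complex.I_im]
        ring
      · simp only [Complex.add_im, Complex.log_im, harg]
        simp only [hwdef, Complex.mul_re, Complex.mul_im, Complex.add_re, Complex.add_im,
          Complex.sub_re, Complex.sub_im, Complex.ofReal_re, Complex.ofReal_im, Complex.I_re, Complex.I_im]
        ring
    have him : (w + Complex.log w).im = -Real.pi := by rw [hsum]; simp
    refine ⟨?_, by linarith, by linarith⟩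
    rw [← hexp, ← hsum, Complex.exp_add, Complex.exp_log hw0, mul_comm]

theorem strictAntiOn_mul_exp :
    StrictAntiOn (fun t : ℝ => t * Real.exp t) (Set.Iic (-1)) := by
  refine strictAntiOn_of_deriv_neg (convex_Iic _) (by fun_prop) fun t ht => ?_
  rw [interior_Iic] at ht
  have hd : HasDerivAt (fun t : ℝ => t * Real.exp t) (1 * Real.exp t + t * Real.exp t) t :=
    (hasDerivAt_id t).mul (Real.hasDerivAt_exp t)
  rw [hd.deriv]
  have := Real.exp_pos t
  have : t < -1 := ht
  nlinarith

theorem exists_mul_exp_eq {x : ℝ} (hx : x < 0) (h : -Real.exp (-1) ≤ x) :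
    ∃ t ≤ -1, t * Real.exp t = x := by
  have hlim : Tendsto (fun t : ℝ => t * Real.exp t) atBot (𝓝 0) := by
    have h1 := (Real.tendsto_pow_mul_exp_neg_atTop_nhds_zero 1).neg.comp tendsto_neg_atBot_atTop
    rw [neg_zero] at h1
    refine h1.congr fun t => ?_
    simp
  have hev := (hlim.eventually_const_le hx).and (eventually_le_atBot (-1 : ℝ))
  obtain ⟨a, ha, ha1⟩ := hev.exists
  obtain ⟨t, ht, hte⟩ := isPreconnected_Iic.intermediate_value (s := Set.Iic (-1 : ℝ))
    (f := fun t : ℝ => t * Real.exp t) (a := -1) (b := a) (by simp) ha1 (by fun_prop)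
    ⟨by simpa using h, ha⟩
  exact ⟨t, ht, hte⟩

theorem existsUnique_isLambertWNegOne {x : ℝ} (hx : x < 0) :
    ∃! w : ℂ, IsLambertWNegOne x w := by
  have key : ∀ w : ℂ, IsLambertWNegOne x w ↔
      (∃ t : ℝ, t ≤ -1 ∧ t * Real.exp t = x ∧ w = t) ∨
      ∃ t ∈ Set.Ioo 0 Real.pi, lambertAux t = Real.log (-x) ∧
        w = ⟨-(t * Real.cos t / Real.sin t), -t⟩ := by
    intro w
    rw [← lambert_nonreal_iff hx w]
    unfold IsLambertWNegOne LambertWNegOneRange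
    rw [and_or_left]
    refine or_congr ⟨?_, ?_⟩ Iff.rfl
    · rintro ⟨h, hi, hr⟩
      have hw : w = (w.re : ℂ) := Complex.ext (by simp) (by simp [hi])
      refine ⟨w.re, hr, ?_, hw⟩
      rw [hw] at h
      exact_mod_cast h
    · rintro ⟨t, ht, h, rfl⟩
      exact ⟨by exact_mod_cast h, by simp, by simpa using ht⟩
  have hreal : ∀ t : ℝ, t ≤ -1 → t * Real.exp t = x → Real.log (-x) ≤ -1 := by
    intro t ht h
    have h1 : -Real.exp (-1) ≤ x := by
      have := strictAntiOn_mul_exp.antitoneOn (Set.mem_Iic.2 ht) (Set.mem_Iic.2 le_rfl) ht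
      change -1 * Real.exp (-1) ≤ t * Real.exp t at this
      rw [h] at this
      linarith
    rw [Real.log_le_iff_le_exp (neg_pos.2 hx)]
    linarith
  by_cases hc : -Real.exp (-1) ≤ x
  · obtain ⟨t, ht, h⟩ := exists_mul_exp_eq hx hc
    refine ⟨t, (key _).2 (Or.inl ⟨t, ht, h, rfl⟩), fun w hw => ?_⟩
    rcases (key w).1 hw with ⟨s, hs, h', rfl⟩ | ⟨s, hs, h', -⟩
    · exact congrArg _ (strictAntiOn_mul_exp.injOn hs ht (h'.trans h.symm))
    · exact absurd (hreal t ht h) (not_le.2 (h' ▸ neg_one_lt_lambertAux hs.1 hs.2))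
  · have hl : -1 < Real.log (-x) := by
      rw [Real.lt_log_iff_exp_lt (neg_pos.2 hx)]
      linarith
    obtain ⟨t, ht, h⟩ := exists_lambertAux_eq hl
    refine ⟨_, (key _).2 (Or.inr ⟨t, ht, h, rfl⟩), fun w hw => ?_⟩
    rcases (key w).1 hw with ⟨s, hs, h', rfl⟩ | ⟨s, hs, h', rfl⟩
    · exact absurd (hreal s hs h') (not_le.2 hl)
    · rw [strictMonoOn_lambertAux.injOn hs ht (h'.trans h.symm)]

theorem isLambertWNegOne_lambertWNegOne {x : ℝ} (hx : x < 0) :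
    IsLambertWNegOne x (lambertWNegOne x) := by
  have h := (existsUnique_isLambertWNegOne hx).exists
  rw [lambertWNegOne, dif_pos h]
  exact h.choose_spec

/-! ### The series -/

/-- The `n`-th term
`∑_{m=1}^{n} (-1)^(n-m) [n, n-m+1] σ^(n-m) τ^m / m!` of the series, where `[n, k]` is the
Stirling cycle number. -/
def comtetTerm (σ τ : ℝ) (n : ℕ) : ℝ :=
  ∑ m ∈ Finset.Icc 1 n, (-1) ^ (n - m) * (Nat.stirlingFirst n (n - m + 1) : ℝ) *
    (σ ^ (n - m) * τ ^ m / (m.factorial : ℝ))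

/-- The series `∑_{n ≥ 1} comtetTerm σ τ n` converges. -/
def ComtetConverges (σ τ : ℝ) : Prop :=
  ∃ u : ℝ, Tendsto (fun N : ℕ => ∑ n ∈ Finset.Icc 1 N, comtetTerm σ τ n) atTop (𝓝 u)

/-- The coefficient of `σ ^ n` in the series when `τ = l * σ`. -/
def comtetCoeff (l : ℝ) (n : ℕ) : ℝ :=
  ∑ m ∈ Finset.Icc 1 n, (-1) ^ (n - m) * (Nat.stirlingFirst n (n - m + 1) : ℝ) *
    (l ^ m / (m.factorial : ℝ))

theorem comtetTerm_mul (σ l : ℝ) (n : ℕ) :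
    comtetTerm σ (l * σ) n = comtetCoeff l n * σ ^ n := by
  unfold comtetTerm comtetCoeff
  rw [Finset.sum_mul]
  refine Finset.sum_congr rfl fun m hm => ?_
  have h : σ ^ n = σ ^ (n - m) * σ ^ m := by
    rw [← pow_add, Nat.sub_add_cancel (Finset.mem_Icc.1 hm).2]
  rw [h, mul_pow]
  ring

end

/-!
Write `τ = l σ`.  The sum `v` of the series solves `exp (-v) = 1 + σ (v - l)`, that is, it is the
local inverse at `0` of `f v = (1 - exp (-v)) / (l - v)` (`comtetInv l`).  Everything rests on
integrals over the boundary of a rectangle `[a, b] × [-t, t]` with `a < 0 < b` and `0 < t < π`,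
inside which `0` is the only zero of `1 - exp (-v)`.

* The residue of `v ^ k / (1 - exp (-v)) ^ (n + 1)` at `0` satisfies the recursion of the Stirling
  cycle numbers.  Hence `∮ f ^ (-n) = n a_n ∮ 1 / (1 - exp (-v))`, where `a_n = comtetCoeff l n`
  (`rectIntegral_quotient_pow`).  On a small rectangle the same integral gives the coefficients of
  the local inverse of `f` (`coeff_local_inverse`), which yields the functional equation
  (`oneSubExpNeg_comtetSeries_sum`).  No residue has to be computed exactly: it suffices that
  `∮ 1 / (1 - exp (-v))` does not vanish.
* If `|f| ≥ R` on the boundary of some rectangle, then `|a_n| = O(R ^ (-n))`, so that the radius of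
  convergence is at least `R` (`le_comtetSeries_radius`).
* If moreover the boundary contains a critical point `c` of `f` with `|f c| = R` that can be
  approached from the part of the rectangle where `|f| < R`, then the radius is not larger than `R`:
  otherwise `v (f z) = z` on that part by the maximum principle for `1 / f`
  (`comtetSeries_sum_comtetInv`), hence `v (f c) = c`, which contradicts `f' c = 0`
  (`comtetSeries_radius_eq`).
* The critical points of `f` are the `c = l - 1 - w` with `w exp w = -exp (l - 1)`, and
  `|f c| = exp (-Re c)`.  For `w = W₋₁(-exp (l - 1))` a rectangle as above exists, with `c` on a
  horizontal side if `l > 0` (`comtetSeries_radius_of_pos`), where `R = sin t / t`, and on the right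
  side if `l < 0` (`comtetSeries_radius_of_neg`), where `R = 1 / s` with `s = -w`.

The domain of convergence is open because `logRadius` is lower semicontinuous: it increases on
`(-∞, 0]` from `-∞` to `0` and decreases on `[0, ∞)`, by its parametrizations through `s` and `t`.
A point of convergence outside of it can be moved out along its ray, or off the axis `τ = 0`, to a
point of divergence (`interior_setOf_comtetConverges`).
-/

noncomputable section

/-! ### Integrals over the boundary of a rectangle -/

/-- The closed rectangle `[a, b] × [-t, t]`. -/
def closedRect (a b t : ℝ) : Set ℂ := Set.Icc a b ×ℂ Set.Icc (-t) t

/-- The open rectangle `(a, b) × (-t, t)`. -/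
def openRect (a b t : ℝ) : Set ℂ := Set.Ioo a b ×ℂ Set.Ioo (-t) t

/-- The boundary of the rectangle `[a, b] × [-t, t]`. -/
def rectBoundary (a b t : ℝ) : Set ℂ := closedRect a b t \ openRect a b t

/-- The integral of `F` over the boundary of the rectangle `[a, b] × [-t, t]`, traversed
counterclockwise. -/
def rectIntegral (a b t : ℝ) (F : ℂ → ℂ) : ℂ :=
  (∫ x : ℝ in a..b, F (x + (-t : ℝ) * Complex.I)) - (∫ x : ℝ in a..b, F (x + t * Complex.I)) +
    Complex.I * (∫ y : ℝ in (-t)..t, F (b + y * Complex.I)) -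
    Complex.I * ∫ y : ℝ in (-t)..t, F (a + y * Complex.I)

theorem mem_closedRect {a b t : ℝ} {v : ℂ} :
    v ∈ closedRect a b t ↔ (a ≤ v.re ∧ v.re ≤ b) ∧ -t ≤ v.im ∧ v.im ≤ t := by
  simp [closedRect, Complex.mem_reProdIm]

theorem mem_openRect {a b t : ℝ} {v : ℂ} :
    v ∈ openRect a b t ↔ (a < v.re ∧ v.re < b) ∧ -t < v.im ∧ v.im < t := by
  simp [openRect, Complex.mem_reProdIm]

theorem isOpen_openRect (a b t : ℝ) : IsOpen (openRect a b t) :=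
  isOpen_Ioo.reProdIm isOpen_Ioo

theorem isClosed_closedRect (a b t : ℝ) : IsClosed (closedRect a b t) :=
  isClosed_Icc.reProdIm isClosed_Icc

theorem openRect_subset_closedRect (a b t : ℝ) : openRect a b t ⊆ closedRect a b t :=
  fun _ h => by
    rw [mem_openRect] at h
    exact mem_closedRect.2 ⟨⟨h.1.1.le, h.1.2.le⟩, h.2.1.le, h.2.2.le⟩

theorem isBounded_closedRect (a b t : ℝ) : Bornology.IsBounded (closedRect a b t) :=
  (Metric.isBounded_Icc a b).reProdIm (Metric.isBounded_Icc (-t) t)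

theorem bottom_mem_rectBoundary {a b t x : ℝ} (ht : 0 < t) (hx : x ∈ Set.Icc a b) :
    (x + (-t : ℝ) * Complex.I : ℂ) ∈ rectBoundary a b t := by
  refine ⟨mem_closedRect.2 ?_, fun h => ?_⟩
  · simpa using ⟨hx, ht.le⟩
  · have := (mem_openRect.1 h).2.1
    simp at this

theorem top_mem_rectBoundary {a b t x : ℝ} (ht : 0 < t) (hx : x ∈ Set.Icc a b) :
    (x + t * Complex.I : ℂ) ∈ rectBoundary a b t := by
  refine ⟨mem_closedRect.2 ?_, fun h => ?_⟩
  · simpa using ⟨hx, ht.le⟩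
  · have := (mem_openRect.1 h).2.2
    simp at this

theorem right_mem_rectBoundary {a b t y : ℝ} (hab : a ≤ b) (hy : y ∈ Set.Icc (-t) t) :
    (b + y * Complex.I : ℂ) ∈ rectBoundary a b t := by
  refine ⟨mem_closedRect.2 ?_, fun h => ?_⟩
  · simpa using ⟨hab, hy⟩
  · have := (mem_openRect.1 h).1.2
    simp at this

theorem left_mem_rectBoundary {a b t y : ℝ} (hab : a ≤ b) (hy : y ∈ Set.Icc (-t) t) :
    (a + y * Complex.I : ℂ) ∈ rectBoundary a b t := by
  refine ⟨mem_closedRect.2 ?_, fun h => ?_⟩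
  · simpa using ⟨hab, hy⟩
  · have := (mem_openRect.1 h).1.1
    simp at this

theorem ne_zero_of_mem_rectBoundary {a b t : ℝ} (ha : a < 0) (hb : 0 < b) (ht : 0 < t) {v : ℂ}
    (hv : v ∈ rectBoundary a b t) : v ≠ 0 := by
  rintro rfl
  exact hv.2 (mem_openRect.2 (by simp [ha, hb, ht]))

theorem intervalIntegrable_sides {a b t : ℝ} (hab : a ≤ b) (ht : 0 < t) {F : ℂ → ℂ}
    (hF : ContinuousOn F (rectBoundary a b t)) :
    IntervalIntegrable (fun x : ℝ => F (x + (-t : ℝ) * Complex.I)) MeasureTheory.volume a b ∧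
    IntervalIntegrable (fun x : ℝ => F (x + t * Complex.I)) MeasureTheory.volume a b ∧
    IntervalIntegrable (fun y : ℝ => F (b + y * Complex.I)) MeasureTheory.volume (-t) t ∧
    IntervalIntegrable (fun y : ℝ => F (a + y * Complex.I)) MeasureTheory.volume (-t) t := by
  have htt : -t ≤ t := by linarith
  refine ⟨ContinuousOn.intervalIntegrable_of_Icc hab ?_,
    ContinuousOn.intervalIntegrable_of_Icc hab ?_,
    ContinuousOn.intervalIntegrable_of_Icc htt ?_,
    ContinuousOn.intervalIntegrable_of_Icc htt ?_⟩
  · exact hF.comp (by fun_prop) fun x hx => bottom_mem_rectBoundary ht hx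
  · exact hF.comp (by fun_prop) fun x hx => top_mem_rectBoundary ht hx
  · exact hF.comp (by fun_prop) fun x hx => right_mem_rectBoundary hab hx
  · exact hF.comp (by fun_prop) fun x hx => left_mem_rectBoundary hab hx

theorem rectIntegral_congr {a b t : ℝ} (hab : a ≤ b) (ht : 0 < t) {F G : ℂ → ℂ}
    (h : Set.EqOn F G (rectBoundary a b t)) : rectIntegral a b t F = rectIntegral a b t G := by
  have htt : -t ≤ t := by linarith
  unfold rectIntegral
  congr 1
  · congr 1
    · congr 1
      · refine intervalIntegral.integral_congr fun x hx => h (bottom_mem_rectBoundary ht ?_)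
        rwa [Set.uIcc_of_le hab] at hx
      · refine intervalIntegral.integral_congr fun x hx => h (top_mem_rectBoundary ht ?_)
        rwa [Set.uIcc_of_le hab] at hx
    · congr 1
      refine intervalIntegral.integral_congr fun x hx => h (right_mem_rectBoundary hab ?_)
      rwa [Set.uIcc_of_le htt] at hx
  · congr 1
    refine intervalIntegral.integral_congr fun x hx => h (left_mem_rectBoundary hab ?_)
    rwa [Set.uIcc_of_le htt] at hx

theorem rectIntegral_add {a b t : ℝ} (hab : a ≤ b) (ht : 0 < t) {F G : ℂ → ℂ}
    (hF : ContinuousOn F (rectBoundary a b t)) (hG : ContinuousOn G (rectBoundary a b t)) :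
    rectIntegral a b t (fun v => F v + G v) = rectIntegral a b t F + rectIntegral a b t G := by
  obtain ⟨f1, f2, f3, f4⟩ := intervalIntegrable_sides hab ht hF
  obtain ⟨g1, g2, g3, g4⟩ := intervalIntegrable_sides hab ht hG
  unfold rectIntegral
  rw [intervalIntegral.integral_add f1 g1, intervalIntegral.integral_add f2 g2,
    intervalIntegral.integral_add f3 g3, intervalIntegral.integral_add f4 g4]
  ring

theorem rectIntegral_const_mul (a b t : ℝ) (c : ℂ) (F : ℂ → ℂ) :
    rectIntegral a b t (fun v => c * F v) = c * rectIntegral a b t F := by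
  unfold rectIntegral
  simp only [intervalIntegral.integral_const_mul]
  ring

theorem rectIntegral_sum {a b t : ℝ} (hab : a ≤ b) (ht : 0 < t) {ι : Type*} (s : Finset ι)
    {F : ι → ℂ → ℂ} (hF : ∀ i ∈ s, ContinuousOn (F i) (rectBoundary a b t)) :
    rectIntegral a b t (fun v => ∑ i ∈ s, F i v) = ∑ i ∈ s, rectIntegral a b t (F i) := by
  classical
  induction s using Finset.induction_on with
  | empty => simp [rectIntegral]
  | insert i s hi ih =>
    simp only [Finset.sum_insert hi]
    rw [rectIntegral_add hab ht (hF i (Finset.mem_insert_self i s))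
      (continuousOn_finsetSum _ fun j hj => hF j (Finset.mem_insert_of_mem hj)),
      ih fun j hj => hF j (Finset.mem_insert_of_mem hj)]

theorem rectIntegral_deriv_eq_zero {a b t : ℝ} (hab : a ≤ b) (ht : 0 < t) {F F' : ℂ → ℂ}
    (hF : ∀ v ∈ rectBoundary a b t, HasDerivAt F (F' v) v)
    (hF' : ContinuousOn F' (rectBoundary a b t)) : rectIntegral a b t F' = 0 := by
  obtain ⟨f1, f2, f3, f4⟩ := intervalIntegrable_sides hab ht hF'
  have htt : -t ≤ t := by linarith
  have hor : ∀ (c x : ℝ), HasDerivAt (fun x : ℝ => (x + c * Complex.I : ℂ)) 1 x := fun c x =>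
    (Complex.ofRealCLM.hasDerivAt (x := x)).add_const _
  have ver : ∀ (c y : ℝ), HasDerivAt (fun y : ℝ => (c + y * Complex.I : ℂ)) Complex.I y :=
    fun c y => by
      simpa using ((Complex.ofRealCLM.hasDerivAt (x := y)).mul_const Complex.I).const_add (c : ℂ)
  have e1 : (∫ x : ℝ in a..b, F' (x + (-t : ℝ) * Complex.I)) =
      F (b + (-t : ℝ) * Complex.I) - F (a + (-t : ℝ) * Complex.I) := by
    refine intervalIntegral.integral_eq_sub_of_hasDerivAt
      (f := fun x : ℝ => F (x + (-t : ℝ) * Complex.I)) (fun x hx => ?_) f1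
    rw [Set.uIcc_of_le hab] at hx
    exact mul_one (F' _) ▸ (hF _ (bottom_mem_rectBoundary ht hx)).comp x (hor (-t) x)
  have e2 : (∫ x : ℝ in a..b, F' (x + t * Complex.I)) =
      F (b + t * Complex.I) - F (a + t * Complex.I) := by
    refine intervalIntegral.integral_eq_sub_of_hasDerivAt
      (f := fun x : ℝ => F (x + t * Complex.I)) (fun x hx => ?_) f2
    rw [Set.uIcc_of_le hab] at hx
    exact mul_one (F' _) ▸ (hF _ (top_mem_rectBoundary ht hx)).comp x (hor t x)
  have e3 : Complex.I * (∫ y : ℝ in (-t)..t, F' (b + y * Complex.I)) =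
      F (b + t * Complex.I) - F (b + (-t : ℝ) * Complex.I) := by
    rw [← intervalIntegral.integral_const_mul]
    refine intervalIntegral.integral_eq_sub_of_hasDerivAt
      (f := fun y : ℝ => F (b + y * Complex.I)) (fun y hy => ?_) (f3.const_mul _)
    rw [Set.uIcc_of_le htt] at hy
    exact mul_comm (F' _) _ ▸ (hF _ (right_mem_rectBoundary hab hy)).comp y (ver b y)
  have e4 : Complex.I * (∫ y : ℝ in (-t)..t, F' (a + y * Complex.I)) =
      F (a + t * Complex.I) - F (a + (-t : ℝ) * Complex.I) := by
    rw [← intervalIntegral.integral_const_mul]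
    refine intervalIntegral.integral_eq_sub_of_hasDerivAt
      (f := fun y : ℝ => F (a + y * Complex.I)) (fun y hy => ?_) (f4.const_mul _)
    rw [Set.uIcc_of_le htt] at hy
    exact mul_comm (F' _) _ ▸ (hF _ (left_mem_rectBoundary hab hy)).comp y (ver a y)
  unfold rectIntegral
  rw [e1, e2, e3, e4]
  ring

theorem rectIntegral_eq_zero_of_differentiableOn {a b t : ℝ} (hab : a ≤ b) (ht : 0 < t)
    {F : ℂ → ℂ} (hF : DifferentiableOn ℂ F (closedRect a b t)) : rectIntegral a b t F = 0 := by
  have htt : -t ≤ t := by linarith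
  have := Complex.integral_boundary_rect_eq_zero_of_differentiableOn F ⟨a, -t⟩ ⟨b, t⟩
    (by
      simp only [Set.uIcc_of_le hab, Set.uIcc_of_le htt]
      exact hF)
  simpa [rectIntegral] using this

theorem norm_rectIntegral_le {a b t : ℝ} (hab : a ≤ b) (ht : 0 < t) {F : ℂ → ℂ} {M : ℝ}
    (hF : ∀ v ∈ rectBoundary a b t, ‖F v‖ ≤ M) :
    ‖rectIntegral a b t F‖ ≤ (2 * (b - a) + 4 * t) * M := by
  have htt : -t ≤ t := by linarith
  have h1 : ‖∫ x : ℝ in a..b, F (x + (-t : ℝ) * Complex.I)‖ ≤ M * |b - a| :=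
    intervalIntegral.norm_integral_le_of_norm_le_const fun x hx =>
      hF _ (bottom_mem_rectBoundary ht (by
        rw [Set.uIoc_of_le hab] at hx; exact Set.Ioc_subset_Icc_self hx))
  have h2 : ‖∫ x : ℝ in a..b, F (x + t * Complex.I)‖ ≤ M * |b - a| :=
    intervalIntegral.norm_integral_le_of_norm_le_const fun x hx =>
      hF _ (top_mem_rectBoundary ht (by
        rw [Set.uIoc_of_le hab] at hx; exact Set.Ioc_subset_Icc_self hx))
  have h3 : ‖∫ y : ℝ in (-t)..t, F (b + y * Complex.I)‖ ≤ M * |t - -t| :=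
    intervalIntegral.norm_integral_le_of_norm_le_const fun x hx =>
      hF _ (right_mem_rectBoundary hab (by
        rw [Set.uIoc_of_le htt] at hx; exact Set.Ioc_subset_Icc_self hx))
  have h4 : ‖∫ y : ℝ in (-t)..t, F (a + y * Complex.I)‖ ≤ M * |t - -t| :=
    intervalIntegral.norm_integral_le_of_norm_le_const fun x hx =>
      hF _ (left_mem_rectBoundary hab (by
        rw [Set.uIoc_of_le htt] at hx; exact Set.Ioc_subset_Icc_self hx))
  rw [abs_of_nonneg (by linarith)] at h1 h2 h3 h4
  unfold rectIntegral
  refine (norm_sub_le _ _).trans ?_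
  refine (add_le_add_left ((norm_add_le _ _).trans
    (add_le_add_left (norm_sub_le _ _) _)) _).trans ?_
  rw [norm_mul, norm_mul, Complex.norm_I, one_mul, one_mul]
  linarith

theorem apply_integral_pos (L : ℂ →L[ℝ] ℝ) {a b : ℝ} (hab : a < b) {f : ℝ → ℂ}
    (hf : IntervalIntegrable f MeasureTheory.volume a b) (hpos : ∀ x ∈ Set.Ioo a b, 0 < L (f x)) :
    0 < L (∫ x in a..b, f x) := by
  rw [← L.intervalIntegral_comp_comm hf]
  exact intervalIntegral.intervalIntegral_pos_of_pos_on
    ⟨L.integrable_comp hf.1, L.integrable_comp hf.2⟩ hpos hab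

/-- Each side of a rectangle around `0` contributes a positive amount to the imaginary part of
the integral of `1 / v`, namely the angle under which it is seen from `0`. -/
theorem rectIntegral_inv_ne_zero {a b t : ℝ} (ha : a < 0) (hb : 0 < b) (ht : 0 < t) :
    rectIntegral a b t (fun v => v⁻¹) ≠ 0 := by
  have hab : a < b := ha.trans hb
  have htt : -t < t := by linarith
  have hc : ContinuousOn (fun v : ℂ => v⁻¹) (rectBoundary a b t) :=
    continuousOn_id.inv₀ fun v hv => ne_zero_of_mem_rectBoundary ha hb ht hv
  obtain ⟨f1, f2, f3, f4⟩ := intervalIntegrable_sides hab.le ht hc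
  have sq : ∀ x y : ℝ, y ≠ 0 → 0 < x * x + y * y := fun x y hy => by
    have := mul_self_pos.2 hy
    nlinarith [mul_self_nonneg x]
  have h1 := apply_integral_pos Complex.imCLM hab f1 fun x _ => by
    have := sq x t ht.ne'
    simp [Complex.normSq_apply]
    positivity
  have h2 := apply_integral_pos (-Complex.imCLM) hab f2 fun x _ => by
    have := sq x t ht.ne'
    simp [Complex.normSq_apply, neg_div]
    positivity
  have h3 := apply_integral_pos Complex.reCLM htt f3 fun y _ => by
    have := sq y b hb.ne'
    simp [Complex.normSq_apply]
    rw [add_comm]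
    positivity
  have h4 := apply_integral_pos (-Complex.reCLM) htt f4 fun y _ => by
    have := sq y a ha.ne
    have ha' : 0 < -a := by linarith
    simp only [neg_apply, Complex.reCLM_apply, Complex.inv_re,
      Complex.normSq_apply]
    simp only [Complex.add_re, Complex.ofReal_re, Complex.mul_re, Complex.I_re, Complex.ofReal_im,
      Complex.I_im, Complex.add_im, Complex.mul_im]
    rw [← neg_div]
    refine div_pos (by linarith) (by linarith)
  simp only [neg_apply, Complex.imCLM_apply, Complex.reCLM_apply] at h1 h2 h3 h4
  intro h
  have him := congrArg Complex.im h
  simp only [rectIntegral, Complex.add_im, Complex.sub_im, Complex.I_mul_im, Complex.zero_im]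
    at him
  linarith

/-! ### Stirling cycle numbers as residues -/

/-- The entire function `v ↦ 1 - exp (-v)`. -/
def oneSubExpNeg (v : ℂ) : ℂ := 1 - Complex.exp (-v)

theorem hasDerivAt_oneSubExpNeg (v : ℂ) : HasDerivAt oneSubExpNeg (Complex.exp (-v)) v := by
  have h := ((hasDerivAt_neg v).cexp).const_sub 1
  exact h.congr_deriv (by simp)

theorem differentiable_oneSubExpNeg : Differentiable ℂ oneSubExpNeg :=
  fun v => (hasDerivAt_oneSubExpNeg v).differentiableAt

@[simp]
theorem oneSubExpNeg_zero : oneSubExpNeg 0 = 0 := by simp [oneSubExpNeg]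

theorem oneSubExpNeg_ne_zero {v : ℂ} (h1 : -Real.pi < v.im) (h2 : v.im < Real.pi) (h : v ≠ 0) :
    oneSubExpNeg v ≠ 0 := by
  intro h0
  have h3 : Complex.exp (-v) = 1 := (sub_eq_zero.1 h0).symm
  obtain ⟨n, hn⟩ := Complex.exp_eq_one_iff.1 h3
  have him := congrArg Complex.im hn
  simp at him
  have hn1 : (-1 : ℝ) < n := by nlinarith
  have hn2 : (n : ℝ) < 1 := by nlinarith
  have hn0 : n = 0 := by
    have : (-1 : ℤ) < n := by exact_mod_cast hn1
    have : n < 1 := by exact_mod_cast hn2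
    omega
  subst hn0
  simp at hn
  exact h hn

theorem oneSubExpNeg_ne_zero_of_mem_closedRect {a b t : ℝ} (htpi : t < Real.pi) {v : ℂ}
    (hv : v ∈ closedRect a b t) (h : v ≠ 0) : oneSubExpNeg v ≠ 0 := by
  have := (mem_closedRect.1 hv).2
  exact oneSubExpNeg_ne_zero (by linarith) (by linarith) h

/-- The entire function `(1 - exp (-v)) / v`. -/
def oneSubExpNegDiv : ℂ → ℂ := dslope oneSubExpNeg 0

theorem differentiable_oneSubExpNegDiv : Differentiable ℂ oneSubExpNegDiv :=
  differentiableOn_univ.1 <| (Complex.differentiableOn_dslope univ_mem).2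
    differentiable_oneSubExpNeg.differentiableOn

theorem mul_oneSubExpNegDiv (v : ℂ) : v * oneSubExpNegDiv v = oneSubExpNeg v := by
  have := sub_smul_dslope oneSubExpNeg 0 v
  simpa [oneSubExpNegDiv] using this

theorem oneSubExpNegDiv_zero : oneSubExpNegDiv 0 = 1 := by
  rw [oneSubExpNegDiv, dslope_same, (hasDerivAt_oneSubExpNeg 0).deriv]
  simp

theorem oneSubExpNegDiv_ne_zero_of_mem_closedRect {a b t : ℝ} (htpi : t < Real.pi) {v : ℂ}
    (hv : v ∈ closedRect a b t) : oneSubExpNegDiv v ≠ 0 := by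
  rcases eq_or_ne v 0 with rfl | h
  · rw [oneSubExpNegDiv_zero]; exact one_ne_zero
  · intro h0
    apply oneSubExpNeg_ne_zero_of_mem_closedRect htpi hv h
    rw [← mul_oneSubExpNegDiv, h0, mul_zero]

section

variable {a b t : ℝ} (ha : a < 0) (hb : 0 < b) (ht : 0 < t) (htpi : t < Real.pi)
include ha hb ht htpi

theorem oneSubExpNeg_ne_zero_of_mem_rectBoundary {v : ℂ} (hv : v ∈ rectBoundary a b t) :
    oneSubExpNeg v ≠ 0 :=
  oneSubExpNeg_ne_zero_of_mem_closedRect htpi hv.1 (ne_zero_of_mem_rectBoundary ha hb ht hv)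

theorem continuousOn_inv_oneSubExpNeg :
    ContinuousOn (fun v => (oneSubExpNeg v)⁻¹) (rectBoundary a b t) :=
  differentiable_oneSubExpNeg.continuous.continuousOn.inv₀ fun _ hv =>
    oneSubExpNeg_ne_zero_of_mem_rectBoundary ha hb ht htpi hv

/-- The difference `1 / (1 - exp (-v)) - 1 / v` extends holomorphically to `0`. -/
theorem rectIntegral_inv_oneSubExpNeg_ne_zero :
    rectIntegral a b t (fun v => (oneSubExpNeg v)⁻¹) ≠ 0 := by
  have hab : a ≤ b := (ha.trans hb).le
  set H : ℂ → ℂ := fun v => -(dslope oneSubExpNegDiv 0 v) / oneSubExpNegDiv v with hH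
  have hd : Differentiable ℂ (dslope oneSubExpNegDiv 0) :=
    differentiableOn_univ.1 <| (Complex.differentiableOn_dslope univ_mem).2
      differentiable_oneSubExpNegDiv.differentiableOn
  have hHd : DifferentiableOn ℂ H (closedRect a b t) :=
    hd.neg.differentiableOn.fun_div differentiable_oneSubExpNegDiv.differentiableOn
      fun v hv => oneSubExpNegDiv_ne_zero_of_mem_closedRect htpi hv
  have hc : ContinuousOn (fun v : ℂ => v⁻¹) (rectBoundary a b t) :=
    continuousOn_id.inv₀ fun v hv => ne_zero_of_mem_rectBoundary ha hb ht hv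
  have key : Set.EqOn (fun v => (oneSubExpNeg v)⁻¹) (fun v => v⁻¹ + H v) (rectBoundary a b t) := by
    intro v hv
    have hv0 := ne_zero_of_mem_rectBoundary ha hb ht hv
    have hE := oneSubExpNegDiv_ne_zero_of_mem_closedRect htpi hv.1
    have hs := sub_smul_dslope oneSubExpNegDiv 0 v
    rw [oneSubExpNegDiv_zero, sub_zero, smul_eq_mul] at hs
    simp only [hH, ← mul_oneSubExpNegDiv]
    field_simp
    rw [hs]
    ring
  rw [rectIntegral_congr hab ht key, rectIntegral_add hab ht hc
    (hHd.continuousOn.mono Set.sdiff_subset),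
    rectIntegral_eq_zero_of_differentiableOn hab ht hHd, add_zero]
  exact rectIntegral_inv_ne_zero ha hb ht

theorem rectIntegral_pow_succ_mul_inv_oneSubExpNeg (k : ℕ) :
    rectIntegral a b t (fun v => v ^ (k + 1) * (oneSubExpNeg v)⁻¹) = 0 := by
  have hab : a ≤ b := (ha.trans hb).le
  have hd : DifferentiableOn ℂ (fun v => v ^ k / oneSubExpNegDiv v) (closedRect a b t) :=
    (differentiable_id.pow k).differentiableOn.fun_div
      differentiable_oneSubExpNegDiv.differentiableOn
      fun v hv => oneSubExpNegDiv_ne_zero_of_mem_closedRect htpi hv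
  rw [← rectIntegral_eq_zero_of_differentiableOn hab ht hd]
  refine rectIntegral_congr hab ht fun v hv => ?_
  have hv0 := ne_zero_of_mem_rectBoundary ha hb ht hv
  have hE := oneSubExpNegDiv_ne_zero_of_mem_closedRect htpi hv.1
  simp only [← mul_oneSubExpNegDiv]
  field_simp
  ring

theorem continuousOn_pow_mul_inv_oneSubExpNeg_pow (k n : ℕ) :
    ContinuousOn (fun v => v ^ k * (oneSubExpNeg v)⁻¹ ^ n) (rectBoundary a b t) :=
  (continuous_id.pow k).continuousOn.mul
    ((continuousOn_inv_oneSubExpNeg ha hb ht htpi).pow n)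

/-- Integration by parts: the derivative of `v ^ k * (1 - exp (-v)) ^ (-(n + 1))` is
`k v ^ (k - 1) (1 - exp (-v)) ^ (-(n + 1))
  - (n + 1) v ^ k ((1 - exp (-v)) ^ (-(n + 2)) - (1 - exp (-v)) ^ (-(n + 1)))`. -/
theorem rectIntegral_pow_mul_inv_oneSubExpNeg_pow_succ (k n : ℕ) :
    (n + 1) * rectIntegral a b t (fun v => v ^ k * (oneSubExpNeg v)⁻¹ ^ (n + 2)) =
      (n + 1) * rectIntegral a b t (fun v => v ^ k * (oneSubExpNeg v)⁻¹ ^ (n + 1)) +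
      k * rectIntegral a b t (fun v => v ^ (k - 1) * (oneSubExpNeg v)⁻¹ ^ (n + 1)) := by
  have hab : a ≤ b := (ha.trans hb).le
  have c1 := continuousOn_pow_mul_inv_oneSubExpNeg_pow ha hb ht htpi k (n + 2)
  have c2 := continuousOn_pow_mul_inv_oneSubExpNeg_pow ha hb ht htpi k (n + 1)
  have c3 := continuousOn_pow_mul_inv_oneSubExpNeg_pow ha hb ht htpi (k - 1) (n + 1)
  have hz : rectIntegral a b t (fun v => (-(n + 1)) * (v ^ k * (oneSubExpNeg v)⁻¹ ^ (n + 2)) +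
      ((n + 1) * (v ^ k * (oneSubExpNeg v)⁻¹ ^ (n + 1)) +
        k * (v ^ (k - 1) * (oneSubExpNeg v)⁻¹ ^ (n + 1)))) = 0 := by
    refine rectIntegral_deriv_eq_zero hab ht (F := fun v => v ^ k * (oneSubExpNeg v)⁻¹ ^ (n + 1))
      (fun v hv => ?_) ?_
    · have hφ := oneSubExpNeg_ne_zero_of_mem_rectBoundary ha hb ht htpi hv
      have h := (hasDerivAt_pow k v).fun_mul
        (((hasDerivAt_oneSubExpNeg v).fun_inv hφ).fun_pow (n + 1))
      refine h.congr_deriv ?_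
      have he : Complex.exp (-v) = 1 - oneSubExpNeg v := by simp [oneSubExpNeg]
      have hi : oneSubExpNeg v * (oneSubExpNeg v)⁻¹ = 1 := mul_inv_cancel₀ hφ
      rw [he, div_eq_mul_inv, ← inv_pow]
      simp only [Nat.add_sub_cancel]
      push_cast
      linear_combination (n + 1 : ℂ) * v ^ k * (oneSubExpNeg v)⁻¹ ^ (n + 1) * hi
    · exact (continuousOn_const.fun_mul c1).fun_add
        ((continuousOn_const.fun_mul c2).fun_add (continuousOn_const.fun_mul c3))
  rw [rectIntegral_add hab ht (continuousOn_const.fun_mul c1)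
      ((continuousOn_const.fun_mul c2).fun_add (continuousOn_const.fun_mul c3)),
    rectIntegral_add hab ht (continuousOn_const.fun_mul c2) (continuousOn_const.fun_mul c3),
    rectIntegral_const_mul, rectIntegral_const_mul, rectIntegral_const_mul] at hz
  linear_combination -hz

/-- The residue of `v ^ k / (1 - exp (-v)) ^ (n + 1)` at `0` is `k! / n!` times the Stirling cycle
number `[n + 1, k + 1]`: both satisfy the same recursion. -/
theorem rectIntegral_pow_mul_inv_oneSubExpNeg_pow (n k : ℕ) :
    rectIntegral a b t (fun v => v ^ k * (oneSubExpNeg v)⁻¹ ^ (n + 1)) =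
      (k.factorial * Nat.stirlingFirst (n + 1) (k + 1) / n.factorial : ℂ) *
        rectIntegral a b t (fun v => (oneSubExpNeg v)⁻¹) := by
  induction n generalizing k with
  | zero =>
    cases k with
    | zero => simp [Nat.stirlingFirst_self]
    | succ k =>
      have := rectIntegral_pow_succ_mul_inv_oneSubExpNeg ha hb ht htpi k
      simp [this, Nat.stirlingFirst_eq_zero_of_lt]
  | succ n ih =>
    have hn : (n + 1 : ℂ) ≠ 0 := by exact_mod_cast Nat.succ_ne_zero n
    have hn' : (n.factorial : ℂ) ≠ 0 := by exact_mod_cast n.factorial_ne_zero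
    have h := rectIntegral_pow_mul_inv_oneSubExpNeg_pow_succ ha hb ht htpi k n
    rw [ih, ih] at h
    apply mul_left_cancel₀ hn
    rw [h, Nat.stirlingFirst_succ_succ (n + 1) k, Nat.factorial_succ n]
    push_cast
    cases k with
    | zero =>
      simp only [Nat.stirlingFirst_succ_zero, Nat.cast_zero]
      field_simp
      push_cast
      ring
    | succ k =>
      rw [Nat.add_sub_cancel, Nat.factorial_succ k]
      push_cast
      field_simp

/-- Lagrange's formula for the coefficients of the series, by expansion of
`(l - v) ^ (n + 1)`. -/
theorem rectIntegral_quotient_pow (l : ℝ) (n : ℕ) :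
    rectIntegral a b t (fun v => (((l : ℂ) - v) / oneSubExpNeg v) ^ (n + 1)) =
      (n + 1) * (comtetCoeff l (n + 1) : ℂ) *
        rectIntegral a b t (fun v => (oneSubExpNeg v)⁻¹) := by
  have hab : a ≤ b := (ha.trans hb).le
  have hexp : ∀ v : ℂ, (((l : ℂ) - v) / oneSubExpNeg v) ^ (n + 1) =
      ∑ m ∈ Finset.range (n + 1 + 1), ((l : ℂ) ^ m * (-1) ^ (n + 1 - m) * (n + 1).choose m) *
        (v ^ (n + 1 - m) * (oneSubExpNeg v)⁻¹ ^ (n + 1)) := by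
    intro v
    rw [div_eq_mul_inv, mul_pow, sub_eq_add_neg, add_pow, Finset.sum_mul]
    refine Finset.sum_congr rfl fun m _ => ?_
    rw [neg_pow v]
    ring
  simp only [hexp]
  rw [rectIntegral_sum hab ht _ fun m _ => continuousOn_const.fun_mul
    (continuousOn_pow_mul_inv_oneSubExpNeg_pow ha hb ht htpi _ _)]
  simp only [rectIntegral_const_mul, rectIntegral_pow_mul_inv_oneSubExpNeg_pow ha hb ht htpi]
  rw [Finset.range_eq_Ico, Finset.sum_eq_sum_Ico_succ_bot (Nat.succ_pos _)]
  have hIcc : Finset.Ico (0 + 1) (n + 1).succ = Finset.Icc 1 (n + 1) := by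
    ext m
    simp
  rw [Nat.stirlingFirst_eq_zero_of_lt (by simp), hIcc, comtetCoeff]
  push_cast
  rw [mul_zero, zero_div, zero_mul, mul_zero, zero_add, Finset.mul_sum, Finset.sum_mul]
  refine Finset.sum_congr rfl fun m hm => ?_
  have hmn := (Finset.mem_Icc.1 hm).2
  have hc : (((n + 1).choose m : ℕ) : ℂ) * m.factorial * (n + 1 - m).factorial =
      (n + 1) * n.factorial := by
    exact_mod_cast (Nat.choose_mul_factorial_mul_factorial hmn).trans (Nat.factorial_succ n)
  have h1 : (n.factorial : ℂ) ≠ 0 := by exact_mod_cast n.factorial_ne_zero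
  have h2 : (m.factorial : ℂ) ≠ 0 := by exact_mod_cast m.factorial_ne_zero
  field_simp
  linear_combination (l : ℂ) ^ m *
    ((n + 1).stirlingFirst (n + 1 - m + 1) : ℂ) *
    rectIntegral a b t (fun v => 1 / oneSubExpNeg v) * hc

end

/-! ### The generating function as a local inverse -/

/-- The function `v ↦ (1 - exp (-v)) / (l - v)`, whose local inverse at `0` is the sum of the
series `∑ comtetCoeff l n * σ ^ n`.  At its pole `l` it has the value `0`, by the convention on
division. -/
def comtetInv (l : ℝ) (v : ℂ) : ℂ := oneSubExpNeg v / (l - v)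

/-- The derivative of `comtetInv l` away from the pole `l`. -/
def comtetInvDeriv (l : ℝ) (v : ℂ) : ℂ := Complex.exp (-v) / (l - v) + oneSubExpNeg v / (l - v) ^ 2

@[simp]
theorem comtetInv_zero (l : ℝ) : comtetInv l 0 = 0 := by simp [comtetInv]

theorem hasDerivAt_comtetInv {l : ℝ} {v : ℂ} (h : v ≠ l) :
    HasDerivAt (comtetInv l) (comtetInvDeriv l v) v := by
  have h' : (l : ℂ) - v ≠ 0 := sub_ne_zero.2 h.symm
  refine ((hasDerivAt_oneSubExpNeg v).fun_div
    ((hasDerivAt_id v).const_sub (l : ℂ)) h').congr_deriv ?_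
  simp only [comtetInvDeriv, id]
  field_simp
  ring

theorem isOpen_ne_ofReal (l : ℝ) : IsOpen {v : ℂ | v ≠ l} := isOpen_ne

theorem differentiableOn_comtetInv (l : ℝ) : DifferentiableOn ℂ (comtetInv l) {v | v ≠ l} :=
  fun _ hv => (hasDerivAt_comtetInv hv).differentiableAt.differentiableWithinAt

theorem differentiableOn_comtetInvDeriv (l : ℝ) :
    DifferentiableOn ℂ (comtetInvDeriv l) {v | v ≠ l} := by
  have hl : DifferentiableOn ℂ (fun v : ℂ => (l : ℂ) - v) {v | v ≠ l} := by fun_prop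
  have hexp : Differentiable ℂ fun v : ℂ => Complex.exp (-v) := by fun_prop
  have h0 : ∀ v ∈ {v : ℂ | v ≠ l}, (l : ℂ) - v ≠ 0 := fun v hv => sub_ne_zero.2 (Ne.symm hv)
  exact (hexp.differentiableOn.fun_div hl h0).fun_add
    (differentiable_oneSubExpNeg.differentiableOn.fun_div (hl.fun_pow 2)
      fun v hv => pow_ne_zero 2 (h0 v hv))

theorem analyticAt_comtetInv {l : ℝ} {v : ℂ} (h : v ≠ l) : AnalyticAt ℂ (comtetInv l) v :=
  (differentiableOn_comtetInv l).analyticAt ((isOpen_ne_ofReal l).mem_nhds h)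

theorem exists_local_inverse_comtetInv {l : ℝ} (hl : l ≠ 0) :
    ∃ g : ℂ → ℂ, AnalyticAt ℂ g 0 ∧ g 0 = 0 ∧ (∀ᶠ v in 𝓝 0, g (comtetInv l v) = v) ∧
      ∀ᶠ s in 𝓝 0, comtetInv l (g s) = s := by
  have h0 : (0 : ℂ) ≠ l := by exact_mod_cast hl.symm
  have hd : comtetInvDeriv l 0 ≠ 0 := by simpa [comtetInvDeriv] using hl
  have hf' := (hasDerivAt_comtetInv h0).hasFDerivAt_equiv hd
  have hf : ContDiffAt ℂ ⊤ (comtetInv l) 0 := (analyticAt_comtetInv h0).contDiffAt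
  have hn : (⊤ : WithTop ℕ∞) ≠ 0 := by simp
  have hs := hf.hasStrictFDerivAt' hf' hn
  refine ⟨hf.localInverse hf' hn, ?_, ?_, hs.eventually_left_inverse, ?_⟩
  · have := hf.to_localInverse hf' hn
    rw [comtetInv_zero] at this
    exact this.analyticAt
  · have := hf.localInverse_apply_image hf' hn
    rwa [comtetInv_zero] at this
  · have := hs.eventually_right_inverse
    rwa [comtetInv_zero] at this

section

variable {a b t : ℝ} (ha : a < 0) (hb : 0 < b) (ht : 0 < t) (htpi : t < Real.pi) {l : ℝ}
  (hl : (l : ℂ) ∉ closedRect a b t)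
include ha hb ht htpi hl

theorem comtetInv_ne_zero_of_mem_rectBoundary {v : ℂ} (hv : v ∈ rectBoundary a b t) :
    comtetInv l v ≠ 0 := by
  refine div_ne_zero (oneSubExpNeg_ne_zero_of_mem_rectBoundary ha hb ht htpi hv)
    (sub_ne_zero.2 ?_)
  rintro rfl
  exact hl hv.1

theorem continuousOn_inv_comtetInv :
    ContinuousOn (fun v => (comtetInv l v)⁻¹) (rectBoundary a b t) :=
  ((differentiableOn_comtetInv l).continuousOn.mono fun _ hv h => hl (h ▸ hv.1)).inv₀
    fun _ hv => comtetInv_ne_zero_of_mem_rectBoundary ha hb ht htpi hl hv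

theorem continuousOn_comtetInvDeriv_mul (n : ℕ) :
    ContinuousOn (fun v => comtetInvDeriv l v * (comtetInv l v)⁻¹ ^ n) (rectBoundary a b t) :=
  ((differentiableOn_comtetInvDeriv l).continuousOn.mono fun _ hv h => hl (h ▸ hv.1)).fun_mul
    ((continuousOn_inv_comtetInv ha hb ht htpi hl).fun_pow n)

/-- The logarithmic derivative of `comtetInv l` differs from `1 / (1 - exp (-v))` by a holomorphic
function. -/
theorem rectIntegral_logDeriv_comtetInv :
    rectIntegral a b t (fun v => comtetInvDeriv l v * (comtetInv l v)⁻¹) =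
      rectIntegral a b t (fun v => (oneSubExpNeg v)⁻¹) := by
  have hab : a ≤ b := (ha.trans hb).le
  have hd : DifferentiableOn ℂ (fun v : ℂ => ((l : ℂ) - v)⁻¹ - 1) (closedRect a b t) := by
    refine DifferentiableOn.sub_const (DifferentiableOn.fun_inv (by fun_prop) fun v hv => ?_) 1
    exact sub_ne_zero.2 fun h => hl (h ▸ hv)
  have key : Set.EqOn (fun v => comtetInvDeriv l v * (comtetInv l v)⁻¹)
      (fun v => (oneSubExpNeg v)⁻¹ + (((l : ℂ) - v)⁻¹ - 1)) (rectBoundary a b t) := by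
    intro v hv
    have h1 := oneSubExpNeg_ne_zero_of_mem_rectBoundary ha hb ht htpi hv
    have h2 : (l : ℂ) - v ≠ 0 := sub_ne_zero.2 fun h => hl (h ▸ hv.1)
    have he : Complex.exp (-v) = 1 - oneSubExpNeg v := by simp [oneSubExpNeg]
    simp only [comtetInvDeriv, comtetInv, he]
    field_simp
    ring
  rw [rectIntegral_congr hab ht key, rectIntegral_add hab ht
    (continuousOn_inv_oneSubExpNeg ha hb ht htpi) (hd.continuousOn.mono Set.sdiff_subset),
    rectIntegral_eq_zero_of_differentiableOn hab ht hd, add_zero]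

theorem rectIntegral_comtetInvDeriv_mul_pow (n : ℕ) :
    rectIntegral a b t (fun v => comtetInvDeriv l v * (comtetInv l v)⁻¹ ^ (n + 2)) = 0 := by
  have hab : a ≤ b := (ha.trans hb).le
  have hn : (n + 1 : ℂ) ≠ 0 := by exact_mod_cast Nat.succ_ne_zero n
  refine rectIntegral_deriv_eq_zero hab ht
    (F := fun v => -(comtetInv l v)⁻¹ ^ (n + 1) / (n + 1)) (fun v hv => ?_)
    (continuousOn_comtetInvDeriv_mul ha hb ht htpi hl (n + 2))
  have h0 := comtetInv_ne_zero_of_mem_rectBoundary ha hb ht htpi hl hv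
  have hvl : v ≠ l := fun h => hl (h ▸ hv.1)
  refine ((((hasDerivAt_comtetInv hvl).fun_inv h0).fun_pow (n + 1)).fun_neg.div_const
    (n + 1 : ℂ)).congr_deriv ?_
  rw [div_eq_mul_inv (-comtetInvDeriv l v), ← inv_pow, div_eq_iff hn]
  push_cast
  ring

/-- The residue at `0` of `h (f v) * f' v / f v ^ (n + 1)`, where `f = comtetInv l`, is the `n`-th
coefficient of `h`. -/
theorem rectIntegral_comp_comtetInv {O : Set ℂ} (hO : IsOpen O) (hO0 : 0 ∈ O)
    (hmaps : Set.MapsTo (comtetInv l) (closedRect a b t) O) (n : ℕ) {h : ℂ → ℂ}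
    {p : FormalMultilinearSeries ℂ ℂ ℂ} (hh : DifferentiableOn ℂ h O)
    (hp : HasFPowerSeriesAt h p 0) :
    rectIntegral a b t
        (fun v => h (comtetInv l v) * (comtetInvDeriv l v * (comtetInv l v)⁻¹ ^ (n + 1))) =
      p.coeff n * rectIntegral a b t (fun v => (oneSubExpNeg v)⁻¹) := by
  have hab : a ≤ b := (ha.trans hb).le
  induction n generalizing h p with
  | zero =>
    have hh' : DifferentiableOn ℂ (dslope h 0) O :=
      (Complex.differentiableOn_dslope (hO.mem_nhds hO0)).2 hh
    have hd : DifferentiableOn ℂ (fun v => dslope h 0 (comtetInv l v) * comtetInvDeriv l v)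
        (closedRect a b t) := by
      have hsub : closedRect a b t ⊆ {v | v ≠ l} := fun v hv h => hl (h ▸ hv)
      exact (hh'.fun_comp ((differentiableOn_comtetInv l).mono hsub) hmaps).fun_mul
        ((differentiableOn_comtetInvDeriv l).mono hsub)
    have key : Set.EqOn
        (fun v => h (comtetInv l v) * (comtetInvDeriv l v * (comtetInv l v)⁻¹ ^ (0 + 1)))
        (fun v => h 0 * (comtetInvDeriv l v * (comtetInv l v)⁻¹ ^ 1) +
          dslope h 0 (comtetInv l v) * comtetInvDeriv l v) (rectBoundary a b t) := by
      intro v hv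
      have h0 := comtetInv_ne_zero_of_mem_rectBoundary ha hb ht htpi hl hv
      have hs := sub_smul_dslope h 0 (comtetInv l v)
      rw [sub_zero, smul_eq_mul] at hs
      have hs' : h (comtetInv l v) = h 0 + comtetInv l v * dslope h 0 (comtetInv l v) := by
        rw [hs]; ring
      have hi : comtetInv l v * (comtetInv l v)⁻¹ = 1 := mul_inv_cancel₀ h0
      simp only [hs']
      linear_combination (dslope h 0 (comtetInv l v) * comtetInvDeriv l v) * hi
    rw [rectIntegral_congr hab ht key, rectIntegral_add hab ht
      (continuousOn_const.fun_mul (continuousOn_comtetInvDeriv_mul ha hb ht htpi hl 1))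
      (hd.continuousOn.mono Set.sdiff_subset), rectIntegral_eq_zero_of_differentiableOn hab ht hd,
      rectIntegral_const_mul, add_zero, ← hp.coeff_zero 1]
    simp only [pow_one]
    rw [rectIntegral_logDeriv_comtetInv ha hb ht htpi hl]
    rfl
  | succ n ih =>
    have hh' : DifferentiableOn ℂ (dslope h 0) O :=
      (Complex.differentiableOn_dslope (hO.mem_nhds hO0)).2 hh
    have hp' := hp.has_fpower_series_dslope_fslope
    have key : Set.EqOn
        (fun v => h (comtetInv l v) * (comtetInvDeriv l v * (comtetInv l v)⁻¹ ^ (n + 1 + 1)))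
        (fun v => h 0 * (comtetInvDeriv l v * (comtetInv l v)⁻¹ ^ (n + 2)) +
          dslope h 0 (comtetInv l v) * (comtetInvDeriv l v * (comtetInv l v)⁻¹ ^ (n + 1)))
        (rectBoundary a b t) := by
      intro v hv
      have h0 := comtetInv_ne_zero_of_mem_rectBoundary ha hb ht htpi hl hv
      have hs := sub_smul_dslope h 0 (comtetInv l v)
      rw [sub_zero, smul_eq_mul] at hs
      have hs' : h (comtetInv l v) = h 0 + comtetInv l v * dslope h 0 (comtetInv l v) := by
        rw [hs]; ring
      have hi : comtetInv l v * (comtetInv l v)⁻¹ = 1 := mul_inv_cancel₀ h0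
      simp only [hs']
      linear_combination (dslope h 0 (comtetInv l v) * comtetInvDeriv l v *
        (comtetInv l v)⁻¹ ^ (n + 1)) * hi
    have hc : ContinuousOn (fun v => dslope h 0 (comtetInv l v) *
        (comtetInvDeriv l v * (comtetInv l v)⁻¹ ^ (n + 1))) (rectBoundary a b t) :=
      (hh'.continuousOn.comp ((differentiableOn_comtetInv l).continuousOn.mono
        fun v hv h => hl (h ▸ hv.1)) fun v hv => hmaps hv.1).fun_mul
        (continuousOn_comtetInvDeriv_mul ha hb ht htpi hl (n + 1))
    rw [rectIntegral_congr hab ht key, rectIntegral_add hab ht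
      (continuousOn_const.fun_mul (continuousOn_comtetInvDeriv_mul ha hb ht htpi hl (n + 2))) hc,
      rectIntegral_const_mul, rectIntegral_comtetInvDeriv_mul_pow ha hb ht htpi hl, mul_zero,
      zero_add, ih hh' hp', FormalMultilinearSeries.coeff_fslope]

/-- Integration by parts in Lagrange's formula. -/
theorem rectIntegral_inv_comtetInv_pow (n : ℕ) :
    rectIntegral a b t (fun v => (comtetInv l v)⁻¹ ^ (n + 1)) =
      (n + 1) * rectIntegral a b t
        (fun v => v * (comtetInvDeriv l v * (comtetInv l v)⁻¹ ^ (n + 2))) := by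
  have hab : a ≤ b := (ha.trans hb).le
  have c1 : ContinuousOn (fun v => (comtetInv l v)⁻¹ ^ (n + 1)) (rectBoundary a b t) :=
    (continuousOn_inv_comtetInv ha hb ht htpi hl).fun_pow (n + 1)
  have c2 : ContinuousOn (fun v => v * (comtetInvDeriv l v * (comtetInv l v)⁻¹ ^ (n + 2)))
      (rectBoundary a b t) :=
    continuousOn_id.mul (continuousOn_comtetInvDeriv_mul ha hb ht htpi hl (n + 2))
  have hz : rectIntegral a b t (fun v => (comtetInv l v)⁻¹ ^ (n + 1) +
      -(n + 1) * (v * (comtetInvDeriv l v * (comtetInv l v)⁻¹ ^ (n + 2)))) = 0 := by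
    refine rectIntegral_deriv_eq_zero hab ht (F := fun v => v * (comtetInv l v)⁻¹ ^ (n + 1))
      (fun v hv => ?_) (c1.fun_add (continuousOn_const.fun_mul c2))
    have h0 := comtetInv_ne_zero_of_mem_rectBoundary ha hb ht htpi hl hv
    have hvl : v ≠ l := fun h => hl (h ▸ hv.1)
    refine ((hasDerivAt_id v).fun_mul
      (((hasDerivAt_comtetInv hvl).fun_inv h0).fun_pow (n + 1))).congr_deriv ?_
    rw [div_eq_mul_inv (-_), ← inv_pow]
    push_cast
    simp only [id]
    ring
  rw [rectIntegral_add hab ht c1 (continuousOn_const.fun_mul c2), rectIntegral_const_mul] at hz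
  linear_combination hz

end

theorem closedRect_subset_ball {e r : ℝ} (h : 2 * e < r) :
    closedRect (-e) e e ⊆ Metric.ball 0 r := by
  intro v hv
  obtain ⟨⟨h1, h2⟩, h3, h4⟩ := mem_closedRect.1 hv
  rw [mem_ball_zero_iff]
  have := Complex.norm_le_abs_re_add_abs_im v
  have := abs_le.2 ⟨h1, h2⟩
  have := abs_le.2 ⟨h3, h4⟩
  linarith

/-- Lagrange inversion: an analytic local inverse of `comtetInv l` has the coefficients
`comtetCoeff l`. -/
theorem coeff_local_inverse {l : ℝ} (hl : l ≠ 0) {g : ℂ → ℂ}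
    {p : FormalMultilinearSeries ℂ ℂ ℂ} (hp : HasFPowerSeriesAt g p 0) (hg0 : g 0 = 0)
    (hg : ∀ᶠ v in 𝓝 0, g (comtetInv l v) = v) (n : ℕ) : p.coeff n = comtetCoeff l n := by
  have h0 : (0 : ℂ) ≠ l := by exact_mod_cast hl.symm
  rcases n with _ | n
  · have : p.coeff 0 = g 0 := hp.coeff_zero _
    simp [this, hg0, comtetCoeff]
  obtain ⟨O, hO0, hOo, hgO⟩ : ∃ O : Set ℂ, 0 ∈ O ∧ IsOpen O ∧ DifferentiableOn ℂ g O := by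
    obtain ⟨O, hO, hOo, h0O⟩ := eventually_nhds_iff.1 hp.analyticAt.eventually_analyticAt
    exact ⟨O, h0O, hOo, fun z hz => (hO z hz).differentiableAt.differentiableWithinAt⟩
  have hcont : ContinuousAt (comtetInv l) 0 := (hasDerivAt_comtetInv h0).continuousAt
  have hmem : ∀ᶠ v in 𝓝 (0 : ℂ), comtetInv l v ∈ O :=
    hcont.eventually_mem (by rw [comtetInv_zero]; exact hOo.mem_nhds hO0)
  have hne : ∀ᶠ v in 𝓝 (0 : ℂ), v ≠ (l : ℂ) := (isOpen_ne_ofReal l).mem_nhds h0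
  obtain ⟨r, hr, hball⟩ := Metric.eventually_nhds_iff_ball.1 (hmem.and (hne.and hg))
  -- the square `[-e, e] × [-e, e]` lies in the disc of radius `r` and in the strip `|Im v| < π`
  set e : ℝ := min (r / 4) 1 with he
  have he0 : 0 < e := lt_min (by linarith) one_pos
  have hepi : e < Real.pi := (min_le_right _ _).trans_lt (by linarith [Real.pi_gt_three])
  have her : 2 * e < r := by linarith [min_le_left (r / 4) 1]
  have hsub := closedRect_subset_ball her
  have hlr : (l : ℂ) ∉ closedRect (-e) e e := fun h => (hball _ (hsub h)).2.1 rfl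
  have hna : -e < 0 := by linarith
  have hC := rectIntegral_inv_oneSubExpNeg_ne_zero hna he0 he0 hepi
  have h1 := rectIntegral_inv_comtetInv_pow hna he0 he0 hepi hlr n
  have h2 := rectIntegral_comp_comtetInv hna he0 he0 hepi hlr hOo hO0
    (fun v hv => (hball _ (hsub hv)).1) (n + 1) hgO hp
  have h3 := rectIntegral_quotient_pow hna he0 he0 hepi l n
  have e1 : (fun v => (comtetInv l v)⁻¹ ^ (n + 1)) =
      fun v => (((l : ℂ) - v) / oneSubExpNeg v) ^ (n + 1) := by
    funext v
    rw [comtetInv, inv_div]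
  have e2 : rectIntegral (-e) e e
      (fun v => v * (comtetInvDeriv l v * (comtetInv l v)⁻¹ ^ (n + 2))) =
      rectIntegral (-e) e e (fun v => g (comtetInv l v) *
        (comtetInvDeriv l v * (comtetInv l v)⁻¹ ^ (n + 1 + 1))) := by
    refine rectIntegral_congr (by linarith) he0 fun v hv => ?_
    simp only [(hball _ (hsub hv.1)).2.2]
  have hn : (n + 1 : ℂ) ≠ 0 := by exact_mod_cast Nat.succ_ne_zero n
  rw [e1, h3, e2, h2, mul_assoc] at h1
  exact (mul_right_cancel₀ hC (mul_left_cancel₀ hn h1)).symm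

/-- The power series `∑ comtetCoeff l n * σ ^ n`. -/
abbrev comtetSeries (l : ℝ) : FormalMultilinearSeries ℂ ℂ ℂ :=
  FormalMultilinearSeries.ofScalars ℂ (fun n : ℕ => (comtetCoeff l n : ℂ))

theorem exists_hasFPowerSeriesAt_comtetSeries {l : ℝ} (hl : l ≠ 0) :
    ∃ g : ℂ → ℂ, HasFPowerSeriesAt g (comtetSeries l) 0 ∧ g 0 = 0 ∧
      ∀ᶠ s in 𝓝 0, comtetInv l (g s) = s := by
  obtain ⟨g, ⟨p, hp⟩, hg0, h1, h2⟩ := exists_local_inverse_comtetInv hl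
  refine ⟨g, ?_, hg0, h2⟩
  have : p = comtetSeries l := by
    refine FormalMultilinearSeries.ext fun n => ?_
    rw [← p.mkPiRing_coeff_eq, ← (comtetSeries l).mkPiRing_coeff_eq,
      FormalMultilinearSeries.coeff_ofScalars, coeff_local_inverse hl hp hg0 h1]
  exact this ▸ hp

theorem comtetSeries_radius_pos {l : ℝ} (hl : l ≠ 0) : 0 < (comtetSeries l).radius := by
  obtain ⟨g, hg, -⟩ := exists_hasFPowerSeriesAt_comtetSeries hl
  exact hg.radius_pos

theorem comtetSeries_sum_zero (l : ℝ) : (comtetSeries l).sum 0 = 0 := by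
  exact (FormalMultilinearSeries.ofScalarsSum_zero (E := ℂ)
    (fun n : ℕ => (comtetCoeff l n : ℂ))).trans (by simp [comtetCoeff])

/-- The functional equation `1 - exp (-v) = σ (l - v)` for the sum `v` of the series, valid in the
whole disc of convergence. -/
theorem oneSubExpNeg_comtetSeries_sum {l : ℝ} (hl : l ≠ 0) {s : ℂ}
    (hs : s ∈ Metric.eball (0 : ℂ) (comtetSeries l).radius) :
    oneSubExpNeg ((comtetSeries l).sum s) = s * (l - (comtetSeries l).sum s) := by
  have h0 : (0 : ℂ) ≠ l := by exact_mod_cast hl.symm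
  have hpos := comtetSeries_radius_pos hl
  have hb := (comtetSeries l).hasFPowerSeriesOnBall hpos
  have han : AnalyticOnNhd ℂ (comtetSeries l).sum (Metric.eball 0 (comtetSeries l).radius) :=
    hb.analyticOnNhd
  obtain ⟨g, hg, hg0, hginv⟩ := exists_hasFPowerSeriesAt_comtetSeries hl
  have hgs : ∀ᶠ s in 𝓝 (0 : ℂ), g s = (comtetSeries l).sum s := by
    obtain ⟨r, hr⟩ := hg
    exact (hr.unique (hb.mono hr.r_pos hr.r_le)).eventuallyEq_of_mem
      (Metric.eball_mem_nhds 0 hr.r_pos)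
  have hgl : ∀ᶠ s in 𝓝 (0 : ℂ), g s ≠ (l : ℂ) :=
    hg.continuousAt.eventually_ne (by rwa [hg0])
  have hφ : AnalyticOnNhd ℂ oneSubExpNeg Set.univ :=
    differentiable_oneSubExpNeg.differentiableOn.analyticOnNhd isOpen_univ
  have hleft : AnalyticOnNhd ℂ (fun s => oneSubExpNeg ((comtetSeries l).sum s))
      (Metric.eball 0 (comtetSeries l).radius) := hφ.comp han fun _ _ => Set.mem_univ _
  have hright : AnalyticOnNhd ℂ (fun s => s * ((l : ℂ) - (comtetSeries l).sum s))
      (Metric.eball 0 (comtetSeries l).radius) :=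
    analyticOnNhd_id.mul (analyticOnNhd_const.sub han)
  refine hleft.eqOn_of_preconnected_of_eventuallyEq hright
    (convex_eball (0 : ℂ) _).isPreconnected (Metric.mem_eball_self hpos) ?_ hs
  filter_upwards [hgs, hgl, hginv] with s h1 h2 h3
  rw [← h1]
  have h4 : (l : ℂ) - g s ≠ 0 := sub_ne_zero.2 h2.symm
  rwa [comtetInv, div_eq_iff h4] at h3

/-! ### The radius of convergence from a rectangle with a critical point on its boundary -/

/-- Cauchy's estimate on a rectangle on whose boundary `comtetInv l` is at least `R` in absolute
value.  The boundary may pass through the pole `l` of `comtetInv l`. -/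
theorem le_comtetSeries_radius {a b t : ℝ} (ha : a < 0) (hb : 0 < b) (ht : 0 < t)
    (htpi : t < Real.pi) {l R : ℝ} (hR : 0 < R)
    (hbd : ∀ v ∈ rectBoundary a b t, R * ‖(l : ℂ) - v‖ ≤ ‖oneSubExpNeg v‖) :
    ENNReal.ofReal R ≤ (comtetSeries l).radius := by
  have hab : a ≤ b := (ha.trans hb).le
  set C := rectIntegral a b t (fun v => (oneSubExpNeg v)⁻¹) with hCdef
  have hC : 0 < ‖C‖ := norm_pos_iff.2 (rectIntegral_inv_oneSubExpNeg_ne_zero ha hb ht htpi)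
  set M := 2 * (b - a) + 4 * t with hM
  have hM0 : 0 ≤ M := by rw [hM]; linarith
  refine (comtetSeries l).le_radius_of_bound (M / ‖C‖) (r := R.toNNReal) fun n => ?_
  rw [Real.coe_toNNReal R hR.le, FormalMultilinearSeries.ofScalars_norm]
  rcases n with _ | n
  · simp only [comtetCoeff]
    simp
    positivity
  have h1 : ‖rectIntegral a b t (fun v => (((l : ℂ) - v) / oneSubExpNeg v) ^ (n + 1))‖ ≤
      M * (R⁻¹) ^ (n + 1) := by
    refine norm_rectIntegral_le hab ht fun v hv => ?_
    rw [norm_pow, norm_div]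
    have hφ := norm_pos_iff.2 (oneSubExpNeg_ne_zero_of_mem_rectBoundary ha hb ht htpi hv)
    refine pow_le_pow_left₀ (by positivity) ?_ _
    rw [div_le_iff₀ hφ, ← div_eq_inv_mul, le_div_iff₀ hR, mul_comm]
    exact hbd v hv
  rw [rectIntegral_quotient_pow ha hb ht htpi, norm_mul, norm_mul, ← hCdef] at h1
  have hn : (1 : ℝ) ≤ ‖(n + 1 : ℂ)‖ := by
    have : (n + 1 : ℂ) = ((n + 1 : ℕ) : ℂ) := by push_cast; rfl
    rw [this, Complex.norm_natCast]
    exact_mod_cast Nat.succ_le_succ (Nat.zero_le n)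
  have h2 : ‖(comtetCoeff l (n + 1) : ℂ)‖ * ‖C‖ ≤ M * (R⁻¹) ^ (n + 1) :=
    (mul_le_mul_of_nonneg_right (le_mul_of_one_le_left (norm_nonneg _) hn) hC.le).trans h1
  rw [le_div_iff₀ hC]
  calc ‖(comtetCoeff l (n + 1) : ℂ)‖ * R ^ (n + 1) * ‖C‖
      = ‖(comtetCoeff l (n + 1) : ℂ)‖ * ‖C‖ * R ^ (n + 1) := by ring
    _ ≤ M * (R⁻¹) ^ (n + 1) * R ^ (n + 1) := by gcongr
    _ = M := by rw [mul_assoc, ← mul_pow, inv_mul_cancel₀ hR.ne', one_pow, mul_one]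

/-- The differentiated functional equation. -/
theorem exists_hasStrictDerivAt_comtetSeries_sum {l : ℝ} (hl : l ≠ 0) {s : ℂ}
    (hs : s ∈ Metric.eball (0 : ℂ) (comtetSeries l).radius) :
    ∃ d : ℂ, HasStrictDerivAt (comtetSeries l).sum d s ∧
      Complex.exp (-(comtetSeries l).sum s) * d = (l - (comtetSeries l).sum s) - s * d := by
  have hb := (comtetSeries l).hasFPowerSeriesOnBall (comtetSeries_radius_pos hl)
  have han : AnalyticAt ℂ (comtetSeries l).sum s := hb.analyticOnNhd s hs
  refine ⟨deriv (comtetSeries l).sum s, han.hasStrictDerivAt, ?_⟩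
  have hd := han.differentiableAt.hasDerivAt
  have h1 := (hasDerivAt_oneSubExpNeg ((comtetSeries l).sum s)).comp s hd
  have h2 := (hasDerivAt_id s).fun_mul (hd.const_sub (l : ℂ))
  have heq : oneSubExpNeg ∘ (comtetSeries l).sum =ᶠ[𝓝 s]
      fun s => id s * ((l : ℂ) - (comtetSeries l).sum s) := by
    filter_upwards [Metric.isOpen_eball.mem_nhds hs] with z hz
    exact oneSubExpNeg_comtetSeries_sum hl hz
  have h3 := (h1.congr_of_eventuallyEq heq.symm).unique h2
  simp only [id] at h3
  rw [h3]
  ring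

/-- If the sum of the series were holomorphic beyond `|σ| = R`, then it would invert `comtetInv l`
on `{v ∈ openRect a b t | |comtetInv l v| < R}`: the set where it does is open and closed
there, and by the maximum principle for `1 / comtetInv l` each component contains the only zero `0`
of `comtetInv l`. -/
theorem comtetSeries_sum_comtetInv {a b t : ℝ} (ha : a < 0) (hb : 0 < b) (ht : 0 < t)
    (htpi : t < Real.pi) {l R : ℝ} (hl : l ≠ 0) (hR : 0 < R)
    (hbd : ∀ v ∈ rectBoundary a b t, R * ‖(l : ℂ) - v‖ ≤ ‖oneSubExpNeg v‖)
    (hlt : ENNReal.ofReal R < (comtetSeries l).radius) {v : ℂ} (hv : v ∈ openRect a b t)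
    (hvR : ‖oneSubExpNeg v‖ < R * ‖(l : ℂ) - v‖) :
    (comtetSeries l).sum (comtetInv l v) = v := by
  set V := (comtetSeries l).sum with hV
  set D := Metric.eball (0 : ℂ) (comtetSeries l).radius with hD
  have hVan : AnalyticOnNhd ℂ V D :=
    ((comtetSeries l).hasFPowerSeriesOnBall (comtetSeries_radius_pos hl)).analyticOnNhd
  have hDo : IsOpen D := Metric.isOpen_eball
  have hDmem : ∀ s : ℂ, ‖s‖ ≤ R → s ∈ D := fun s hs => by
    rw [hD, Metric.mem_eball, edist_zero_right, ← ofReal_norm]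
    exact (ENNReal.ofReal_le_ofReal hs).trans_lt hlt
  set S : Set ℂ := {v | v ∈ openRect a b t ∧ ‖oneSubExpNeg v‖ < R * ‖(l : ℂ) - v‖} with hS
  have hφc : Continuous oneSubExpNeg := differentiable_oneSubExpNeg.continuous
  have hSo : IsOpen S := (isOpen_openRect a b t).inter
    (isOpen_lt hφc.norm (by fun_prop))
  have hSl : ∀ v ∈ S, v ≠ (l : ℂ) := by
    rintro v ⟨-, h⟩ rfl
    rw [sub_self, norm_zero, mul_zero] at h
    exact absurd h (norm_nonneg _).not_gt
  have hSf : ∀ v ∈ S, comtetInv l v ∈ D := fun v hv => by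
    have h0 : 0 < ‖(l : ℂ) - v‖ := norm_pos_iff.2 (sub_ne_zero.2 (hSl v hv).symm)
    apply hDmem
    rw [comtetInv, norm_div, div_le_iff₀ h0]
    exact hv.2.le
  have hVf : ContinuousOn (fun v => V (comtetInv l v)) S :=
    hVan.continuousOn.comp ((differentiableOn_comtetInv l).continuousOn.mono hSl) hSf
  set A : Set ℂ := {v | v ∈ S ∧ V (comtetInv l v) = v} with hA
  -- `V` has nonzero derivative at `comtetInv l v`, hence its values cover a neighbourhood of `v`
  have hAo : IsOpen A := by
    rw [isOpen_iff_mem_nhds]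
    rintro v ⟨hvS, hvV⟩
    have hs := hSf v hvS
    obtain ⟨d, hd, hde⟩ := exists_hasStrictDerivAt_comtetSeries_sum hl hs
    have hd0 : d ≠ 0 := by
      rintro rfl
      rw [mul_zero, mul_zero, sub_zero, ← hV, hvV] at hde
      exact hSl v hvS (sub_eq_zero.1 hde.symm).symm
    have hmap := hd.map_nhds_eq hd0
    rw [← hV, hvV] at hmap
    rw [← hmap, mem_map]
    have hcont : ContinuousAt V (comtetInv l v) := hd.hasDerivAt.continuousAt
    have hVS : ∀ᶠ s in 𝓝 (comtetInv l v), V s ∈ S :=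
      hcont.eventually_mem (by rw [hvV]; exact hSo.mem_nhds hvS)
    filter_upwards [hVS, hDo.mem_nhds hs] with s h1 h2
    refine ⟨h1, ?_⟩
    have h3 : (l : ℂ) - V s ≠ 0 := sub_ne_zero.2 (hSl _ h1).symm
    have h4 : comtetInv l (V s) = s := by
      rw [comtetInv, div_eq_iff h3]
      exact oneSubExpNeg_comtetSeries_sum hl h2
    rw [h4]
  have hUo : IsOpen (S \ A) := by
    have h1 : S \ A = S ∩ (fun v => V (comtetInv l v) - v) ⁻¹' {0}ᶜ := by
      ext v
      simp only [hA, Set.mem_sdiff, Set.mem_ofPred_eq, Set.mem_inter_iff, Set.mem_preimage,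
        Set.mem_compl_iff, Set.mem_singleton_iff, sub_eq_zero, not_and]
      tauto
    rw [h1]
    exact (hVf.sub continuousOn_id).isOpen_inter_preimage hSo isOpen_compl_singleton
  have h0A : (0 : ℂ) ∈ A := by
    refine ⟨⟨mem_openRect.2 (by simp [ha, hb, ht]), ?_⟩, ?_⟩
    · have : 0 < ‖(l : ℂ)‖ := norm_pos_iff.2 (by exact_mod_cast hl)
      simp only [oneSubExpNeg_zero, norm_zero, sub_zero]
      positivity
    · rw [comtetInv_zero]
      exact comtetSeries_sum_zero l
  have hdisj : ∀ z ∈ A, z ∉ closure (S \ A) := fun z hz hzc => by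
    obtain ⟨y, hyA, hy⟩ := mem_closure_iff.1 hzc A hAo hz
    exact hy.2 hyA
  have hcl : closure (S \ A) ⊆ closedRect a b t :=
    closure_minimal (fun z hz => openRect_subset_closedRect a b t hz.1.1)
      (isClosed_closedRect a b t)
  by_contra hne
  have hvU : v ∈ S \ A := ⟨⟨hv, hvR⟩, fun h => hne h.2⟩
  have hφ0 : ∀ z ∈ closure (S \ A), oneSubExpNeg z ≠ 0 := fun z hz =>
    oneSubExpNeg_ne_zero_of_mem_closedRect htpi (hcl hz) fun h => hdisj 0 h0A (h ▸ hz)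
  have hqd : DifferentiableOn ℂ (fun z => ((l : ℂ) - z) / oneSubExpNeg z) (closure (S \ A)) :=
    DifferentiableOn.fun_div (by fun_prop) differentiable_oneSubExpNeg.differentiableOn hφ0
  obtain ⟨z, hzf, hzmax⟩ := Complex.exists_mem_frontier_isMaxOn_norm
    ((isBounded_closedRect a b t).subset fun z hz => hcl (subset_closure hz)) ⟨v, hvU⟩
    hqd.diffContOnCl
  have hzc : z ∈ closure (S \ A) := frontier_subset_closure hzf
  have hzU : z ∉ S \ A := fun h => by
    rw [frontier, hUo.interior_eq] at hzf
    exact hzf.2 h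
  have hzS : z ∉ S := fun h => by
    by_cases hzA : z ∈ A
    · exact hdisj z hzA hzc
    · exact hzU ⟨h, hzA⟩
  have hzR : R * ‖(l : ℂ) - z‖ ≤ ‖oneSubExpNeg z‖ := by
    by_cases hzo : z ∈ openRect a b t
    · exact not_lt.1 fun h => hzS ⟨hzo, h⟩
    · exact hbd z ⟨hcl hzc, hzo⟩
  have hmax : ‖((l : ℂ) - v) / oneSubExpNeg v‖ ≤ ‖((l : ℂ) - z) / oneSubExpNeg z‖ :=
    hzmax (subset_closure hvU)
  have hφv := norm_pos_iff.2 (hφ0 v (subset_closure hvU))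
  have hφz := norm_pos_iff.2 (hφ0 z hzc)
  rw [norm_div, norm_div, div_le_div_iff₀ hφv hφz] at hmax
  have h1 := mul_lt_mul_of_pos_right hvR hφz
  have h2 := mul_le_mul_of_nonneg_right hzR hφv.le
  have h3 := mul_le_mul_of_nonneg_left hmax hR.le
  nlinarith

/-- If the rectangle has on its boundary a critical point `c` of `comtetInv l` with
`|comtetInv l c| = R` that is accessible from the points where `|comtetInv l| < R`, then the
radius of convergence is exactly `R`.  A critical point satisfies
`comtetInv l c = -exp (-c)`. -/
theorem comtetSeries_radius_eq {a b t : ℝ} (ha : a < 0) (hb : 0 < b) (ht : 0 < t)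
    (htpi : t < Real.pi) {l R : ℝ} (hl : l ≠ 0)
    (hbd : ∀ v ∈ rectBoundary a b t, R * ‖(l : ℂ) - v‖ ≤ ‖oneSubExpNeg v‖) {c : ℂ}
    (hcl : c ≠ l) (hcR : Real.exp (-c.re) = R)
    (hcrit : oneSubExpNeg c = -Complex.exp (-c) * (l - c))
    (hc : c ∈ closure {v | v ∈ openRect a b t ∧ ‖oneSubExpNeg v‖ < R * ‖(l : ℂ) - v‖}) :
    (comtetSeries l).radius = ENNReal.ofReal R := by
  have hR : 0 < R := hcR ▸ Real.exp_pos _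
  refine le_antisymm (not_lt.1 fun hlt => ?_) (le_comtetSeries_radius ha hb ht htpi hR hbd)
  have hlc : (l : ℂ) - c ≠ 0 := sub_ne_zero.2 hcl.symm
  have hfc : comtetInv l c = -Complex.exp (-c) := by rw [comtetInv, div_eq_iff hlc, hcrit]
  have hsD : comtetInv l c ∈ Metric.eball (0 : ℂ) (comtetSeries l).radius := by
    rw [Metric.mem_eball, edist_zero_right, ← ofReal_norm, hfc, norm_neg,
      Complex.norm_exp, Complex.neg_re, hcR]
    exact hlt
  obtain ⟨d, hd, hde⟩ := exists_hasStrictDerivAt_comtetSeries_sum hl hsD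
  have hVc : (comtetSeries l).sum (comtetInv l c) = c := by
    have hcont : ContinuousAt (fun v => (comtetSeries l).sum (comtetInv l v)) c :=
      ContinuousAt.comp (f := comtetInv l) hd.hasDerivAt.continuousAt
        (hasDerivAt_comtetInv hcl).continuousAt
    have := mem_closure_iff_nhdsWithin_neBot.1 hc
    refine tendsto_nhds_unique
      (l := 𝓝[{v | v ∈ openRect a b t ∧ ‖oneSubExpNeg v‖ < R * ‖(l : ℂ) - v‖}] c)
      (hcont.tendsto.mono_left nhdsWithin_le_nhds)
      ((tendsto_id.mono_left nhdsWithin_le_nhds).congr' ?_)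
    filter_upwards [self_mem_nhdsWithin] with v hv
    exact (comtetSeries_sum_comtetInv ha hb ht htpi hl hR hbd hlt hv.1 hv.2).symm
  -- at a critical point the differentiated functional equation degenerates to `l - c = 0`
  rw [hVc, hfc] at hde
  exact hlc (by linear_combination -hde)

/-! ### Rectangles adapted to the critical points -/

theorem norm_sq_oneSubExpNeg (v : ℂ) :
    ‖oneSubExpNeg v‖ ^ 2 =
      (Real.exp (-v.re) - Real.cos v.im) ^ 2 + Real.sin v.im ^ 2 := by
  have h := Real.sin_sq_add_cos_sq v.im
  rw [← Complex.normSq_eq_norm_sq, Complex.normSq_apply]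
  simp only [oneSubExpNeg, Complex.sub_re, Complex.sub_im, Complex.one_re, Complex.one_im,
    Complex.exp_re, Complex.exp_im, Complex.neg_re, Complex.neg_im, Real.cos_neg, Real.sin_neg]
  linear_combination (Real.exp (-v.re) ^ 2 - 1) * h

theorem norm_sq_ofReal_sub (l : ℝ) (v : ℂ) : ‖(l : ℂ) - v‖ ^ 2 = (l - v.re) ^ 2 + v.im ^ 2 := by
  rw [← Complex.normSq_eq_norm_sq, Complex.normSq_apply]
  simp
  ring

theorem mul_norm_le_norm_oneSubExpNeg {l R : ℝ} {v : ℂ}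
    (h : R ^ 2 * ((l - v.re) ^ 2 + v.im ^ 2) ≤
      (Real.exp (-v.re) - Real.cos v.im) ^ 2 + Real.sin v.im ^ 2) :
    R * ‖(l : ℂ) - v‖ ≤ ‖oneSubExpNeg v‖ := by
  refine le_of_sq_le_sq ?_ (norm_nonneg _)
  rw [mul_pow, norm_sq_oneSubExpNeg, norm_sq_ofReal_sub]
  exact h

theorem norm_oneSubExpNeg_lt_mul_norm {l R : ℝ} (hR : 0 ≤ R) {v : ℂ}
    (h : (Real.exp (-v.re) - Real.cos v.im) ^ 2 + Real.sin v.im ^ 2 <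
      R ^ 2 * ((l - v.re) ^ 2 + v.im ^ 2)) :
    ‖oneSubExpNeg v‖ < R * ‖(l : ℂ) - v‖ := by
  refine lt_of_pow_lt_pow_left₀ 2 (mul_nonneg hR (norm_nonneg _)) ?_
  rw [mul_pow, norm_sq_oneSubExpNeg, norm_sq_ofReal_sub]
  exact h

/-- The function `sin y / y` is decreasing on `(0, π)`. -/
theorem sin_mul_lt_sin_mul {y t : ℝ} (hy : 0 < y) (hyt : y < t) (ht : t < Real.pi) :
    Real.sin t * y < Real.sin y * t := by
  have ht0 : 0 < t := hy.trans hyt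
  have h0 : (0 : ℝ) ∈ Set.Icc 0 Real.pi := ⟨le_rfl, Real.pi_pos.le⟩
  have ha : 0 < 1 - y / t := sub_pos.2 ((div_lt_one ht0).2 hyt)
  have h := strictConcaveOn_sin_Icc.2 h0 ⟨ht0.le, ht.le⟩ ht0.ne ha (div_pos hy ht0) (by ring)
  simp only [smul_eq_mul, Real.sin_zero, mul_zero, zero_add] at h
  rw [div_mul_cancel₀ _ ht0.ne', div_mul_eq_mul_div, div_lt_iff₀ ht0] at h
  linarith

theorem sin_mul_abs_le {y t : ℝ} (hy : |y| ≤ t) (ht : t < Real.pi) :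
    Real.sin t * |y| ≤ |Real.sin y| * t := by
  have h : |Real.sin y| = Real.sin |y| := by
    rw [Real.abs_sin_eq_sin_abs_of_abs_le_pi (hy.trans ht.le)]
  rw [h]
  rcases (abs_nonneg y).eq_or_lt with h0 | h0
  · rw [← h0]; simp
  rcases hy.eq_or_lt with h1 | h1
  · rw [h1]
  · exact (sin_mul_lt_sin_mul h0 h1 ht).le

/-- The estimate on the left side of the rectangle.  The choice of `L` makes `L + L ^ 2 / 2`,
a lower bound for `exp L - 1`, at least `L + |l| + t`. -/
theorem left_side_estimate {l t y L R : ℝ} (ht : 0 < t) (hy : |y| ≤ t) (hR0 : 0 ≤ R) (hR : R ≤ 1)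
    (hL : L = 1 + 2 * (|l| + t)) :
    R ^ 2 * ((l - -L) ^ 2 + y ^ 2) ≤
      (Real.exp (- -L) - Real.cos y) ^ 2 + Real.sin y ^ 2 := by
  have hl0 := abs_nonneg l
  have hL0 : 0 ≤ L := by rw [hL]; positivity
  have h1 := Real.quadratic_le_exp_of_nonneg hL0
  have h2 : 2 * (|l| + t) ≤ L ^ 2 := by nlinarith
  have h3 : L + |l| + t ≤ Real.exp L - Real.cos y := by linarith [Real.cos_le_one y]
  have h4 : (l - -L) ^ 2 ≤ (L + |l|) ^ 2 :=
    sq_le_sq' (by linarith [neg_abs_le l]) (by linarith [le_abs_self l])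
  have h5 : y ^ 2 ≤ t ^ 2 := by rw [← sq_abs y]; gcongr
  have h6 : (L + |l| + t) ^ 2 ≤ (Real.exp L - Real.cos y) ^ 2 := by gcongr
  have h7 : R ^ 2 ≤ 1 := pow_le_one₀ hR0 hR
  have h8 : 0 ≤ (l - -L) ^ 2 + y ^ 2 := by positivity
  rw [neg_neg]
  have : 0 ≤ (L + |l|) * t := by positivity
  nlinarith [sq_nonneg (Real.sin y)]

theorem sides_of_mem_rectBoundary {a b t : ℝ} {v : ℂ} (hv : v ∈ rectBoundary a b t) :
    v.re ≤ b ∧ |v.im| ≤ t ∧ (v.re = a ∨ v.re = b ∨ |v.im| = t) := by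
  obtain ⟨h, ho⟩ := hv
  obtain ⟨⟨h1, h2⟩, h3, h4⟩ := mem_closedRect.1 h
  refine ⟨h2, abs_le.2 ⟨h3, h4⟩, ?_⟩
  by_contra! hne
  refine ho (mem_openRect.2 ⟨⟨lt_of_le_of_ne h1 hne.1.symm, lt_of_le_of_ne h2 hne.2.1⟩, ?_⟩)
  exact abs_lt.1 (lt_of_le_of_ne (abs_le.2 ⟨h3, h4⟩) hne.2.2)

/-- For `l > 0` the rectangle is `[-L, l] × [-t, t]`, and the critical points on its boundary are
`-log R ± i t`, on the horizontal sides. -/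
theorem comtetSeries_radius_of_pos {l t : ℝ} (hl : 0 < l) (ht : 0 < t) (htpi : t < Real.pi)
    (hlt : lambertAux t = l - 1) :
    (comtetSeries l).radius = ENNReal.ofReal (Real.sin t / t) := by
  have hs : 0 < Real.sin t := Real.sin_pos_of_pos_of_lt_pi ht htpi
  set R := Real.sin t / t with hRdef
  have hR : 0 < R := div_pos hs ht
  have hRt : R * t = Real.sin t := div_mul_cancel₀ _ ht.ne'
  have hR1 : R ≤ 1 := (div_le_one ht).2 (Real.sin_lt ht).le
  have hlog : Real.log R = Real.log (Real.sin t) - Real.log t := Real.log_div hs.ne' ht.ne'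
  have hlogR : Real.log R ≤ 0 := Real.log_nonpos hR.le hR1
  have hla : l + Real.log R = 1 - t * Real.cos t / Real.sin t := by
    unfold lambertAux at hlt
    linarith
  have hRla : R * (l + Real.log R) = R - Real.cos t := by
    rw [hla, hRdef]
    field_simp
  have hpos : 0 < l + Real.log R := by
    rw [hla, sub_pos, div_lt_one hs]
    exact mul_cos_lt_sin ht htpi
  have hsc := Real.sin_sq_add_cos_sq t
  set L := 1 + 2 * (|l| + t) with hL
  have hL0 : 0 < L := by positivity
  have hexp : Real.exp (- -Real.log R) = R := by rw [neg_neg, Real.exp_log hR]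
  refine comtetSeries_radius_eq (neg_neg_of_pos hL0) hl ht htpi hl.ne' (fun v hv => ?_)
    (c := ⟨-Real.log R, t⟩) ?_ hexp ?_ ?_
  · apply mul_norm_le_norm_oneSubExpNeg
    obtain ⟨h1, h2, h3⟩ := sides_of_mem_rectBoundary hv
    -- the left side, the right side and the horizontal sides
    rcases h3 with h | h | h
    · rw [h]
      exact left_side_estimate ht h2 hR.le hR1 hL
    · have := sin_mul_abs_le h2 htpi
      have h4 : R * |v.im| ≤ |Real.sin v.im| := by
        rw [hRdef, div_mul_eq_mul_div, div_le_iff₀ ht]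
        exact this
      have h5 : R ^ 2 * v.im ^ 2 ≤ Real.sin v.im ^ 2 := by
        rw [← sq_abs v.im, ← sq_abs (Real.sin v.im), ← mul_pow]
        gcongr
      rw [h, sub_self]
      nlinarith [sq_nonneg (Real.exp (-l) - Real.cos v.im)]
    · have hc : Real.cos v.im = Real.cos t := by rw [← Real.cos_abs, h]
      have hsn : Real.sin v.im ^ 2 = Real.sin t ^ 2 := by rw [Real.sin_sq, Real.sin_sq, hc]
      have him : v.im ^ 2 = t ^ 2 := by rw [← sq_abs, h]
      -- the tangent of the convex function `exp (-x)` at `x = -log R`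
      have htan : R * (1 - v.re - Real.log R) ≤ Real.exp (-v.re) := by
        have h4 := Real.add_one_le_exp (-v.re - Real.log R)
        rw [Real.exp_sub, Real.exp_log hR, le_div_iff₀ hR] at h4
        linarith
      have h5 : R * (l - v.re) ≤ Real.exp (-v.re) - Real.cos t := by nlinarith
      have h6 : 0 ≤ R * (l - v.re) := mul_nonneg hR.le (by linarith)
      have h7 : (R * (l - v.re)) ^ 2 ≤ (Real.exp (-v.re) - Real.cos t) ^ 2 := by gcongr
      rw [hc, hsn, him, ← hRt]
      nlinarith
  · intro h
    have := congrArg Complex.im h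
    simp at this
    exact ht.ne' this
  · apply Complex.ext
    · simp [oneSubExpNeg, Complex.exp_re, Complex.exp_im, Real.exp_log hR]
      linear_combination Real.cos t * hRla - Real.sin t * hRt - hsc
    · simp [oneSubExpNeg, Complex.exp_re, Complex.exp_im, Real.exp_log hR]
      linear_combination (-Real.sin t) * hRla - Real.cos t * hRt
  · -- On the vertical line through the critical point, `|1 - exp (-v)|² - R² |l - v|²` is `R` times
    -- the following function of `y = Im v`, up to a constant, and vanishes at `y = t`.
    have hmono : StrictMonoOn (fun y : ℝ => -2 * Real.cos y - R * y ^ 2) (Set.Icc 0 t) := by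
      refine strictMonoOn_of_deriv_pos (convex_Icc 0 t) (by fun_prop) fun y hy => ?_
      rw [interior_Icc] at hy
      have hd : HasDerivAt (fun y : ℝ => -2 * Real.cos y - R * y ^ 2)
          (-2 * -Real.sin y - R * (2 * y ^ (2 - 1) * 1)) y :=
        ((Real.hasDerivAt_cos y).const_mul (-2)).fun_sub
          (((hasDerivAt_id y).fun_pow 2).const_mul R)
      rw [hd.deriv]
      have := sin_mul_lt_sin_mul hy.1 hy.2 htpi
      have h4 : R * y < Real.sin y := by
        rw [hRdef, div_mul_eq_mul_div, div_lt_iff₀ ht]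
        exact this
      simp only [Nat.add_one_sub_one, pow_one, mul_one]
      linarith
    have hlim : Tendsto (fun y : ℝ => (⟨-Real.log R, y⟩ : ℂ)) (𝓝[<] t)
        (𝓝 ⟨-Real.log R, t⟩) := by
      have hcont : Continuous fun y : ℝ => (⟨-Real.log R, y⟩ : ℂ) := by
        have : (fun y : ℝ => (⟨-Real.log R, y⟩ : ℂ)) =
            fun y : ℝ => ((-Real.log R : ℝ) : ℂ) + y * Complex.I := by
          funext y
          apply Complex.ext <;> simp
        rw [this]
        fun_prop
      exact (hcont.tendsto t).mono_left nhdsWithin_le_nhds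
    refine mem_closure_of_tendsto hlim ?_
    filter_upwards [Ioo_mem_nhdsLT ht] with y hy
    refine ⟨mem_openRect.2 ⟨⟨by simp only; linarith, by simp only; linarith⟩,
      by simp only; linarith [hy.1], hy.2⟩, norm_oneSubExpNeg_lt_mul_norm hR.le ?_⟩
    have h4 := hmono ⟨hy.1.le, hy.2.le⟩ ⟨ht.le, le_rfl⟩ hy.2
    simp only at h4 ⊢
    have h5 := Real.sin_sq_add_cos_sq y
    have h6 : R ^ 2 * (l + Real.log R) ^ 2 = (R - Real.cos t) ^ 2 := by
      rw [← hRla]; ring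
    have h7 : R ^ 2 * t ^ 2 = Real.sin t ^ 2 := by rw [← hRt]; ring
    rw [hexp, sub_neg_eq_add]
    nlinarith [mul_lt_mul_of_pos_left h4 hR]

/-- For `l < 0` the rectangle is `[-L, log s] × [-t, t]` with `cos t = 2 / s - 1`, that is
`cos (t / 2) ^ 2 = 1 / s`, and the critical point on its boundary is `log s`, on the right side. -/
theorem comtetSeries_radius_of_neg {l s : ℝ} (hl : l < 0) (hs : 1 ≤ s)
    (hls : Real.log s - s = l - 1) :
    (comtetSeries l).radius = ENNReal.ofReal s⁻¹ := by
  have hs1 : 1 < s := by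
    refine lt_of_le_of_ne hs ?_
    rintro rfl
    rw [Real.log_one] at hls
    linarith
  have hs0 : 0 < s := by linarith
  have hR : 0 < s⁻¹ := inv_pos.2 hs0
  have hR1 : s⁻¹ < 1 := inv_lt_one_of_one_lt₀ hs1
  have hss : s * s⁻¹ = 1 := mul_inv_cancel₀ hs0.ne'
  have hb : 0 < Real.log s := Real.log_pos hs1
  set t := Real.arccos (2 * s⁻¹ - 1) with htdef
  have hcos : Real.cos t = 2 * s⁻¹ - 1 := Real.cos_arccos (by linarith) (by linarith)
  have ht : 0 < t := Real.arccos_pos.2 (by linarith)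
  have htpi : t < Real.pi := by
    refine lt_of_le_of_ne (Real.arccos_le_pi _) fun h => ?_
    rw [h, Real.cos_pi] at hcos
    linarith
  have hu : Real.cos (t / 2) ^ 2 = s⁻¹ := by
    rw [Real.cos_sq, mul_div_cancel₀ _ two_ne_zero, hcos]
    ring
  have hcu : 0 < Real.cos (t / 2) := Real.cos_pos_of_mem_Ioo ⟨by linarith, by linarith⟩
  have hsu : t / 2 * Real.cos (t / 2) < Real.sin (t / 2) :=
    mul_cos_lt_sin (by linarith) (by linarith)
  have hsint : s⁻¹ * t ≤ Real.sin t := by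
    have h1 : Real.sin t = 2 * Real.sin (t / 2) * Real.cos (t / 2) := by
      rw [← Real.sin_two_mul, mul_div_cancel₀ _ two_ne_zero]
    rw [h1, ← hu]
    nlinarith
  set L := 1 + 2 * (|l| + t) with hL
  have hL0 : 0 < L := by positivity
  have hexp : Real.exp (-Real.log s) = s⁻¹ := by rw [Real.exp_neg, Real.exp_log hs0]
  refine comtetSeries_radius_eq (neg_neg_of_pos hL0) hb ht htpi hl.ne (fun v hv => ?_)
    (c := (Real.log s : ℝ)) ?_ (by rw [Complex.ofReal_re, hexp]) ?_ ?_
  · apply mul_norm_le_norm_oneSubExpNeg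
    obtain ⟨h1, h2, h3⟩ := sides_of_mem_rectBoundary hv
    -- the left side, the right side and the horizontal sides
    rcases h3 with h | h | h
    · rw [h]
      exact left_side_estimate ht h2 hR.le hR1.le hL
    · rw [h, hexp]
      have h4 : |v.im| / 2 * Real.cos (t / 2) ≤ |Real.sin (v.im / 2)| := by
        have h5 := sin_mul_abs_le (y := v.im / 2) (t := t / 2)
          (by rw [abs_div, abs_two]; linarith) (by linarith)
        rw [abs_div, abs_two] at h5
        have h6 : |v.im| / 2 * Real.cos (t / 2) * (t / 2) ≤ |Real.sin (v.im / 2)| * (t / 2) := by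
          nlinarith [mul_le_mul_of_nonneg_left hsu.le (abs_nonneg v.im)]
        exact le_of_mul_le_mul_right h6 (by linarith)
      have h5 : (v.im / 2) ^ 2 * s⁻¹ ≤ Real.sin (v.im / 2) ^ 2 := by
        rw [← hu, ← sq_abs (v.im / 2), ← sq_abs (Real.sin (v.im / 2)), ← mul_pow, abs_div, abs_two]
        gcongr
      have h6 : Real.cos v.im = 1 - 2 * Real.sin (v.im / 2) ^ 2 := by
        rw [Real.sin_sq_eq_half_sub, mul_div_cancel₀ _ two_ne_zero]
        ring
      have h7 := Real.sin_sq_add_cos_sq v.im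
      have h8 : s⁻¹ ^ 2 * (l - Real.log s) ^ 2 = (1 - s⁻¹) ^ 2 := by
        have : l - Real.log s = 1 - s := by linarith
        rw [this]
        linear_combination (s * s⁻¹ + 1 - 2 * s⁻¹) * hss
      nlinarith [mul_le_mul_of_nonneg_left h5 hR.le]
    · have hc : Real.cos v.im = Real.cos t := by rw [← Real.cos_abs, h]
      have hsn : Real.sin v.im ^ 2 = Real.sin t ^ 2 := by rw [Real.sin_sq, Real.sin_sq, hc]
      have him : v.im ^ 2 = t ^ 2 := by rw [← sq_abs, h]
      -- the tangent of the convex function `exp (-x)` at `x = log s`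
      have htan : s⁻¹ * (l - v.re) + 1 ≤ Real.exp (-v.re) := by
        have h4 := Real.add_one_le_exp (-v.re + Real.log s)
        rw [Real.exp_add, Real.exp_log hs0] at h4
        have h5 := mul_le_mul_of_nonneg_left h4 hR.le
        nlinarith
      have h4 : s⁻¹ * |l - v.re| ≤ Real.exp (-v.re) - Real.cos t := by
        rcases abs_cases (l - v.re) with ⟨h, -⟩ | ⟨h, -⟩
        · rw [h, hcos]
          linarith
        · rw [h, hcos]
          have h6 : s⁻¹ * (v.re - l) ≤ s⁻¹ * (s - 1) :=
            mul_le_mul_of_nonneg_left (by linarith) hR.le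
          nlinarith
      have h5 : (s⁻¹ * |l - v.re|) ^ 2 ≤ (Real.exp (-v.re) - Real.cos t) ^ 2 := by gcongr
      have h6 : (s⁻¹ * t) ^ 2 ≤ Real.sin t ^ 2 := by gcongr
      rw [mul_pow, sq_abs] at h5
      rw [hc, hsn, him, mul_add]
      rw [mul_pow] at h6
      linarith
  · intro h
    have h4 : Real.log s = l := by exact_mod_cast h
    linarith
  · have h4 : Real.log s - l = s - 1 := by linarith
    have h5 : (1 : ℝ) - s⁻¹ = -s⁻¹ * (l - Real.log s) := by
      linear_combination hss.symm - s⁻¹ * h4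
    have h6 : Complex.exp (-((Real.log s : ℝ) : ℂ)) = ((s⁻¹ : ℝ) : ℂ) := by
      rw [← Complex.ofReal_neg, ← Complex.ofReal_exp, hexp]
    rw [oneSubExpNeg, h6]
    exact_mod_cast h5
  · have hlim : Tendsto (fun x : ℝ => (x : ℂ)) (𝓝[<] (Real.log s)) (𝓝 ((Real.log s : ℝ) : ℂ)) :=
      (Complex.continuous_ofReal.tendsto _).mono_left nhdsWithin_le_nhds
    refine mem_closure_of_tendsto hlim ?_
    filter_upwards [Ioo_mem_nhdsLT hb] with x hx
    refine ⟨mem_openRect.2 (by simpa using ⟨⟨by linarith [hx.1], hx.2⟩, ht⟩),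
      norm_oneSubExpNeg_lt_mul_norm hR.le ?_⟩
    rw [Complex.ofReal_re, Complex.ofReal_im, Real.cos_zero, Real.sin_zero]
    have h4 := Real.add_one_lt_exp (x := -x + Real.log s) (by linarith [hx.2])
    rw [Real.exp_add, Real.exp_log hs0] at h4
    have h6 : 1 - Real.exp (-x) < s⁻¹ * (x - l) := by
      rw [← div_eq_inv_mul, lt_div_iff₀ hs0]
      linarith
    have h7 : 0 < 1 - Real.exp (-x) := by
      have : Real.exp (-x) < 1 := Real.exp_lt_one_iff.2 (by linarith [hx.1])
      linarith
    have h8 : (1 - Real.exp (-x)) ^ 2 < (s⁻¹ * (x - l)) ^ 2 := by gcongr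
    nlinarith

/-! ### The logarithm of the radius of convergence -/

/-- The logarithm of the radius of convergence of `comtetSeries l`, for `l ≠ 0`.  At `l = 0`, where
the series vanishes, its value is `0`. -/
def logRadius (l : ℝ) : ℝ := 1 - l + (lambertWNegOne ((-Real.exp (l - 1) : ℝ) : ℂ)).re

theorem lambertWNegOne_eq {x : ℝ} (hx : x < 0) {w : ℂ} (hw : IsLambertWNegOne x w) :
    lambertWNegOne x = w :=
  (existsUnique_isLambertWNegOne hx).unique (isLambertWNegOne_lambertWNegOne hx) hw

theorem exists_logRadius_of_pos {l : ℝ} (hl : 0 < l) :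
    ∃ t ∈ Set.Ioo 0 Real.pi, lambertAux t = l - 1 ∧ logRadius l = Real.log (Real.sin t / t) := by
  obtain ⟨t, ht, hlt⟩ := exists_lambertAux_eq (y := l - 1) (by linarith)
  have hs : 0 < Real.sin t := Real.sin_pos_of_pos_of_lt_pi ht.1 ht.2
  refine ⟨t, ht, hlt, ?_⟩
  have hx : -Real.exp (l - 1) < 0 := neg_neg_of_pos (Real.exp_pos _)
  have hw := (lambert_nonreal_iff hx _).2
    ⟨t, ht, by rw [neg_neg, Real.log_exp, hlt], rfl⟩
  rw [logRadius, lambertWNegOne_eq hx ⟨hw.1, Or.inr hw.2⟩, Real.log_div hs.ne' ht.1.ne']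
  unfold lambertAux at hlt
  simp only
  linarith

theorem exists_logRadius_of_nonpos {l : ℝ} (hl : l ≤ 0) :
    ∃ s : ℝ, 1 ≤ s ∧ Real.log s - s = l - 1 ∧ logRadius l = -Real.log s := by
  have hx : -Real.exp (l - 1) < 0 := neg_neg_of_pos (Real.exp_pos _)
  obtain ⟨u, hu, hue⟩ := exists_mul_exp_eq hx (neg_le_neg (Real.exp_le_exp.2 (by linarith)))
  have hlog : Real.log (-u) + u = l - 1 := by
    have h : Real.exp (l - 1) = -u * Real.exp u := by linarith
    have := congrArg Real.log h
    rw [Real.log_exp, Real.log_mul (by linarith) (Real.exp_pos u).ne', Real.log_exp] at this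
    exact this.symm
  refine ⟨-u, by linarith, by linarith, ?_⟩
  have hw : lambertWNegOne ((-Real.exp (l - 1) : ℝ) : ℂ) = (u : ℂ) :=
    lambertWNegOne_eq hx ⟨by rw [← hue]; push_cast; rfl, Or.inl ⟨by simp, by simpa using hu⟩⟩
  rw [logRadius, hw, Complex.ofReal_re]
  linarith

theorem comtetSeries_radius {l : ℝ} (hl : l ≠ 0) :
    (comtetSeries l).radius = ENNReal.ofReal (Real.exp (logRadius l)) := by
  rcases hl.lt_or_gt with h | h
  · obtain ⟨s, hs, hls, hr⟩ := exists_logRadius_of_nonpos h.le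
    rw [comtetSeries_radius_of_neg h hs hls, hr, Real.exp_neg, Real.exp_log (by linarith)]
  · obtain ⟨t, ht, hlt, hr⟩ := exists_logRadius_of_pos h
    rw [comtetSeries_radius_of_pos h ht.1 ht.2 hlt, hr,
      Real.exp_log (div_pos (Real.sin_pos_of_pos_of_lt_pi ht.1 ht.2) ht.1)]

theorem logRadius_zero : logRadius 0 = 0 := by
  obtain ⟨s, hs, hls, hr⟩ := exists_logRadius_of_nonpos le_rfl
  rcases eq_or_ne s 1 with rfl | h
  · simpa using hr
  · have := Real.log_lt_sub_one_of_pos (by linarith) h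
    linarith

theorem logRadius_neg_of_pos {l : ℝ} (hl : 0 < l) : logRadius l < 0 := by
  obtain ⟨t, ht, -, hr⟩ := exists_logRadius_of_pos hl
  rw [hr]
  exact Real.log_neg (div_pos (Real.sin_pos_of_pos_of_lt_pi ht.1 ht.2) ht.1)
    ((div_lt_one ht.1).2 (Real.sin_lt ht.1))

theorem sub_log_lt_sub_log {x y : ℝ} (hx : 1 ≤ x) (hxy : x < y) :
    x - Real.log x < y - Real.log y := by
  have hx0 : 0 < x := by linarith
  have h1 := Real.log_lt_sub_one_of_pos (div_pos (hx0.trans hxy) hx0)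
    ((one_lt_div hx0).2 hxy).ne'
  rw [Real.log_div (hx0.trans hxy).ne' hx0.ne'] at h1
  have h2 : y / x - 1 ≤ y - x := by
    rw [div_sub_one hx0.ne', div_le_iff₀ hx0]
    nlinarith
  linarith

/-- Lower semicontinuity of `logRadius` on `(-∞, 0]`, where it is increasing. -/
theorem exists_lt_logRadius_of_nonpos {l c : ℝ} (hl : l ≤ 0) (hc : c < logRadius l) :
    ∃ l₁ < l, ∀ l', l₁ < l' → l' ≤ 0 → c < logRadius l' := by
  obtain ⟨s, hs, hls, hr⟩ := exists_logRadius_of_nonpos hl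
  have hs0 : 0 < s := by linarith
  rw [hr] at hc
  have hcont : ContinuousAt (fun x => -Real.log x) s := (Real.continuousAt_log hs0.ne').neg
  have hev : ∀ᶠ x in 𝓝[>] s, c < -Real.log x :=
    nhdsWithin_le_nhds (hcont.eventually_const_lt hc)
  obtain ⟨s₁, hs₁, hss⟩ := (hev.and self_mem_nhdsWithin).exists
  refine ⟨1 + Real.log s₁ - s₁, by linarith [sub_log_lt_sub_log hs hss], fun l' h1 h2 => ?_⟩
  obtain ⟨s', hs', hls', hr'⟩ := exists_logRadius_of_nonpos h2
  have hle : s' ≤ s₁ := by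
    by_contra! h
    linarith [sub_log_lt_sub_log (hs.trans hss.le) h]
  rw [hr']
  linarith [Real.log_le_log (by linarith) hle]

/-- Lower semicontinuity of `logRadius` on `[0, ∞)`, where it is decreasing. -/
theorem exists_lt_logRadius_of_nonneg {l c : ℝ} (hl : 0 ≤ l) (hc : c < logRadius l) :
    ∃ l₂ > l, ∀ l', 0 < l' → l' < l₂ → c < logRadius l' := by
  have hpi := Real.pi_pos
  obtain ⟨t, ht0, htpi, hr, hlt⟩ : ∃ t, 0 ≤ t ∧ t < Real.pi ∧
      logRadius l = Real.log (Real.sinc t) ∧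
      ∀ x ∈ Set.Ioo t Real.pi, l < 1 + lambertAux x := by
    rcases hl.eq_or_lt with rfl | hl
    · refine ⟨0, le_rfl, hpi, by simp [logRadius_zero], fun x hx => ?_⟩
      linarith [neg_one_lt_lambertAux hx.1 hx.2]
    · obtain ⟨t, ht, h1, h2⟩ := exists_logRadius_of_pos hl
      refine ⟨t, ht.1.le, ht.2, by rw [h2, Real.sinc_of_ne_zero ht.1.ne'], fun x hx => ?_⟩
      have := strictMonoOn_lambertAux ht ⟨ht.1.trans hx.1, hx.2⟩ hx.1
      linarith
  have hsinc : Real.sinc t ≠ 0 := by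
    rcases ht0.eq_or_lt with rfl | h
    · simp
    · rw [Real.sinc_of_ne_zero h.ne']
      exact (div_pos (Real.sin_pos_of_pos_of_lt_pi h htpi) h).ne'
  rw [hr] at hc
  have hcont : ContinuousAt (fun x => Real.log (Real.sinc x)) t :=
    Real.continuous_sinc.continuousAt.log hsinc
  have hev : ∀ᶠ x in 𝓝[>] t, c < Real.log (Real.sinc x) :=
    nhdsWithin_le_nhds (hcont.eventually_const_lt hc)
  obtain ⟨t₁, h1, ht₁⟩ := (hev.and (Ioo_mem_nhdsGT htpi)).exists
  have ht₁0 : 0 < t₁ := ht0.trans_lt ht₁.1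
  rw [Real.sinc_of_ne_zero ht₁0.ne'] at h1
  refine ⟨1 + lambertAux t₁, hlt t₁ ht₁, fun l' h2 h3 => ?_⟩
  obtain ⟨t', ht', h4, h5⟩ := exists_logRadius_of_pos h2
  have hlt' : t' < t₁ :=
    (strictMonoOn_lambertAux.lt_iff_lt ht' ⟨ht₁0, ht₁.2⟩).1 (by linarith)
  rw [h5]
  refine h1.trans (Real.log_lt_log
    (div_pos (Real.sin_pos_of_pos_of_lt_pi ht₁0 ht₁.2) ht₁0) ?_)
  rw [div_lt_div_iff₀ ht₁0 ht'.1]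
  exact sin_mul_lt_sin_mul ht'.1 hlt' ht₁.2

theorem eventually_lt_logRadius {l c : ℝ} (hc : c < logRadius l) :
    ∀ᶠ l' in 𝓝 l, c < logRadius l' := by
  rcases lt_trichotomy l 0 with h | rfl | h
  · obtain ⟨l₁, h1, h2⟩ := exists_lt_logRadius_of_nonpos h.le hc
    filter_upwards [Ioo_mem_nhds h1 h] with l' hl'
    exact h2 l' hl'.1 hl'.2.le
  · obtain ⟨l₁, h1, h2⟩ := exists_lt_logRadius_of_nonpos le_rfl hc
    obtain ⟨l₂, h3, h4⟩ := exists_lt_logRadius_of_nonneg le_rfl hc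
    filter_upwards [Ioo_mem_nhds h1 h3] with l' hl'
    rcases le_or_gt l' 0 with h | h
    · exact h2 l' hl'.1 h
    · exact h4 l' h hl'.2
  · obtain ⟨l₂, h3, h4⟩ := exists_lt_logRadius_of_nonneg h.le hc
    filter_upwards [Ioo_mem_nhds h h3] with l' hl'
    exact h4 l' hl'.1 hl'.2

/-! ### The domain of convergence -/

theorem comtetConverges_of_log_lt {σ τ : ℝ} (hσ : 0 < σ) (h : Real.log σ < logRadius (τ / σ)) :
    ComtetConverges σ τ := by
  rcases eq_or_ne τ 0 with rfl | hτ
  · have hz : ∀ n, comtetTerm σ 0 n = 0 := fun n => by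
      refine Finset.sum_eq_zero fun m hm => ?_
      have : m ≠ 0 := by
        have := (Finset.mem_Icc.1 hm).1
        omega
      simp [this]
    exact ⟨0, by simp [hz]⟩
  have hl : τ / σ ≠ 0 := div_ne_zero hτ hσ.ne'
  have hlt : ((σ.toNNReal : NNReal) : ENNReal) < (comtetSeries (τ / σ)).radius := by
    rw [comtetSeries_radius hl]
    exact (ENNReal.ofReal_lt_ofReal_iff (Real.exp_pos _)).2 ((Real.log_lt_iff_lt_exp hσ).1 h)
  have hsum := (comtetSeries (τ / σ)).summable_norm_mul_pow hlt
  have hsum' : Summable (comtetTerm σ τ) := by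
    refine Summable.of_norm (hsum.congr fun n => ?_)
    conv_rhs => rw [← div_mul_cancel₀ τ hσ.ne', comtetTerm_mul]
    rw [FormalMultilinearSeries.ofScalars_norm, Real.coe_toNNReal σ hσ.le, Complex.norm_real,
      norm_mul, norm_pow, Real.norm_of_nonneg hσ.le]
  refine ⟨_, (hsum'.hasSum.tendsto_sum_nat.comp (tendsto_add_atTop_nat 1)).congr fun N => ?_⟩
  have h0 : comtetTerm σ τ 0 = 0 := by simp [comtetTerm]
  rw [Function.comp_apply, Finset.range_eq_Ico, Finset.sum_eq_sum_Ico_succ_bot N.succ_pos, h0,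
    zero_add]
  refine Finset.sum_congr ?_ fun _ _ => rfl
  ext m
  simp

theorem not_comtetConverges_of_lt_log {σ τ : ℝ} (hσ : 0 < σ) (hτ : τ ≠ 0)
    (h : logRadius (τ / σ) < Real.log σ) : ¬ ComtetConverges σ τ := by
  rintro ⟨u, hu⟩
  have hl : τ / σ ≠ 0 := div_ne_zero hτ hσ.ne'
  have h0 : Tendsto (fun n => comtetTerm σ τ (n + 1)) atTop (𝓝 0) := by
    have := (hu.comp (tendsto_add_atTop_nat 1)).sub hu
    rw [sub_self] at this
    refine this.congr fun N => ?_
    rw [Function.comp_apply, Finset.sum_Icc_succ_top (by omega), add_sub_cancel_left]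
  have h1 : Tendsto (fun n => ‖comtetSeries (τ / σ) n‖ * ((σ.toNNReal : NNReal) : ℝ) ^ n) atTop
      (𝓝 0) := by
    refine ((tendsto_add_atTop_iff_nat 1).1 h0).norm.congr' ?_ |>.trans (by simp)
    refine Eventually.of_forall fun n => ?_
    simp only
    conv_lhs => rw [← div_mul_cancel₀ τ hσ.ne', comtetTerm_mul]
    rw [FormalMultilinearSeries.ofScalars_norm, Real.coe_toNNReal σ hσ.le, Complex.norm_real,
      norm_mul, norm_pow, Real.norm_of_nonneg hσ.le]
  have h2 := (comtetSeries (τ / σ)).le_radius_of_tendsto h1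
  rw [comtetSeries_radius hl] at h2
  have h3 : σ ≤ Real.exp (logRadius (τ / σ)) :=
    (ENNReal.ofReal_le_ofReal_iff (Real.exp_pos _).le).1 h2
  exact absurd ((Real.log_le_iff_le_exp hσ).2 h3) (not_le.2 h)

theorem isOpen_setOf_log_lt_logRadius :
    IsOpen {p : ℝ × ℝ | 0 < p.1 ∧ Real.log p.1 < logRadius (p.2 / p.1)} := by
  rw [isOpen_iff_mem_nhds]
  rintro p ⟨hp, hlt⟩
  obtain ⟨c, hc1, hc2⟩ := exists_between hlt
  have h1 : ∀ᶠ q : ℝ × ℝ in 𝓝 p, 0 < q.1 := continuousAt_fst.eventually_const_lt hp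
  have h2 : ∀ᶠ q : ℝ × ℝ in 𝓝 p, Real.log q.1 < c :=
    (continuousAt_fst.log hp.ne').eventually_lt_const hc1
  have h3 : ∀ᶠ q : ℝ × ℝ in 𝓝 p, c < logRadius (q.2 / q.1) :=
    (ContinuousAt.div continuousAt_snd continuousAt_fst hp.ne').eventually
      (eventually_lt_logRadius hc2)
  filter_upwards [h1, h2, h3] with q hq1 hq2 hq3
  exact ⟨hq1, hq2.trans hq3⟩

theorem interior_setOf_comtetConverges :
    interior {p : ℝ × ℝ | 0 < p.1 ∧ ComtetConverges p.1 p.2} =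
      {p : ℝ × ℝ | 0 < p.1 ∧ Real.log p.1 < logRadius (p.2 / p.1)} := by
  refine Set.Subset.antisymm (fun p hp => ?_) (interior_maximal
    (fun p hp => ⟨hp.1, comtetConverges_of_log_lt hp.1 hp.2⟩) isOpen_setOf_log_lt_logRadius)
  have hp1 : 0 < p.1 := (interior_subset hp).1
  have hnhds := mem_interior_iff_mem_nhds.1 hp
  refine ⟨hp1, not_le.1 fun hle => ?_⟩
  rcases eq_or_ne p.2 0 with h0 | h0
  · -- on the axis `τ = 0` the series is trivial, but it diverges at `(σ, τ)` for small `τ > 0`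
    have hlim : Tendsto (fun e : ℝ => ((p.1, e) : ℝ × ℝ)) (𝓝[>] 0) (𝓝 p) := by
      have : Continuous fun e : ℝ => ((p.1, e) : ℝ × ℝ) := by fun_prop
      have h := this.tendsto 0
      have hp0 : ((p.1, 0) : ℝ × ℝ) = p := Prod.ext rfl h0.symm
      rw [hp0] at h
      exact h.mono_left nhdsWithin_le_nhds
    obtain ⟨e, he, he0⟩ := ((hlim.eventually hnhds).and self_mem_nhdsWithin).exists
    rw [h0, zero_div, logRadius_zero] at hle
    exact not_comtetConverges_of_lt_log hp1 he0.ne'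
      ((logRadius_neg_of_pos (div_pos he0 hp1)).trans_le hle) he.2
  · -- move outwards along the ray through `p`
    have hlim : Tendsto (fun k : ℝ => ((k * p.1, k * p.2) : ℝ × ℝ)) (𝓝[>] 1) (𝓝 p) := by
      have : Continuous fun k : ℝ => ((k * p.1, k * p.2) : ℝ × ℝ) := by fun_prop
      have h := this.tendsto 1
      rw [one_mul, one_mul] at h
      exact h.mono_left nhdsWithin_le_nhds
    obtain ⟨k, hk, hk1⟩ := ((hlim.eventually hnhds).and self_mem_nhdsWithin).exists
    have hk0 : 0 < k := by linarith
    refine not_comtetConverges_of_lt_log (mul_pos hk0 hp1) (mul_ne_zero hk0.ne' h0) ?_ hk.2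
    rw [mul_div_mul_left _ _ hk0.ne', Real.log_mul hk0.ne' hp1.ne']
    linarith [Real.log_pos hk1]

end

theorem mainTheorem1 :
    -- for fixed `l = τ / σ`, the exact radius of convergence in the complex variable `σ`
    (∀ l : ℝ, l ≠ 0 →
      (FormalMultilinearSeries.ofScalars ℂ (fun n : ℕ => (comtetCoeff l n : ℂ))).radius =
        ENNReal.ofReal (Real.exp (1 - l + (lambertWNegOne ((-Real.exp (l - 1) : ℝ) : ℂ)).re))) ∧
    -- convergence where the inequality holds
    (∀ σ τ : ℝ, 0 < σ →
      Real.log σ < 1 - τ / σ + (lambertWNegOne ((-Real.exp (τ / σ - 1) : ℝ) : ℂ)).re →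
      ComtetConverges σ τ) ∧
    -- divergence where the opposite strict inequality holds
    (∀ σ τ : ℝ, 0 < σ → τ ≠ 0 →
      1 - τ / σ + (lambertWNegOne ((-Real.exp (τ / σ - 1) : ℝ) : ℂ)).re < Real.log σ →
      ¬ ComtetConverges σ τ) ∧
    -- the domain of convergence (the interior of the set of points of convergence)
    interior {p : ℝ × ℝ | 0 < p.1 ∧ ComtetConverges p.1 p.2} =
      {p : ℝ × ℝ | 0 < p.1 ∧
        Real.log p.1 <
          1 - p.2 / p.1 + (lambertWNegOne ((-Real.exp (p.2 / p.1 - 1) : ℝ) : ℂ)).re} :=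
  ⟨fun _ hl => comtetSeries_radius hl, fun _ _ hσ h => comtetConverges_of_log_lt hσ h,
    fun _ _ hσ hτ h => not_comtetConverges_of_lt_log hσ hτ h, interior_setOf_comtetConverges⟩
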